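/- Let $L,\varepsilon>0$, $R=L\sqrt{\tfrac23+\tfrac1{\sqrt3}}$, $\Omega=\{(x,y)\in\mathbb R^2: x^2+y^2<R^2\}$, $t=\tan(\pi/12)$, and $T_k=Lt^{2k}$ for $k=0,1,2,\dots$. For a matrix $M$ put $M_{sym}=\frac12(M+M^T)$, $M_{skew}=\frac12(M-M^T)$, and let $$E_1=\varepsilon\begin{pmatrix}1&0\\0&-1\end{pmatrix},\quad E_2=\varepsilon\begin{pmatrix}-\frac12&\frac{\sqrt3}2\\ \frac{\sqrt3}2&\frac12\end{pmatrix},\quad E_3=\varepsilon\begin{pmatrix}-\frac12&-\frac{\sqrt3}2\\-\frac{\sqrt3}2&\frac12\end{pmatrix}.$$ **Cells.** For $k\ge0$ let - $\omega_{A_k}=\{(x,y)\in\Omega:\ y<\sqrt3x+\frac{T_k}{\sqrt3},\ x<\frac{T_k}{2\sqrt3},\ y>-\frac{x}{\sqrt3}+(\frac23-\frac1{\sqrt3})T_k,\ y>(\frac1{\sqrt3}-\frac12)T_k\}$, - $\omega_{E_k}=\{(x,y)\in\Omega:\ y>-\frac{T_k}{2\sqrt3},\ y<\frac{x}{\sqrt3}+\frac{T_k}3,\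 y<-\sqrt3x+(1-\frac2{\sqrt3})T_k,\ x<(\frac12-\frac1{\sqrt3})T_k\}$, - $\omega_{F_k}=\{(x,y)\in\Omega:\ y<-\sqrt3x+\frac{T_k}{\sqrt3},\ y>-\frac{x}{\sqrt3}-\frac{T_k}3,\ y<\frac{x}{\sqrt3}+(\frac1{\sqrt3}-\frac23)T_k,\ y<\sqrt3x+(1-\frac2{\sqrt3})T_k\}$, - $\omega_{B_k}=\{(x,y)\in\Omega:\ y>\sqrt3x+\frac{T_k}{\sqrt3},\ y>\frac{x}{\sqrt3}+\frac{T_k}3$, and, if $k\ge1$, also $y<-\frac{x}{\sqrt3}+(\frac23-\frac1{\sqrt3})T_{k-1},\ y>-\sqrt3x+(1-\frac2{\sqrt3})T_{k-1}\}$, - $\omega_{C_k}=\{(x,y)\in\Omega:\ y>-\sqrt3x+\frac{T_k}{\sqrt3},\ x>\frac{T_k}{2\sqrt3}$, and, if $k\ge1$, also $y<(\frac1{\sqrt3}-\frac12)T_{k-1},\ y>\frac{x}{\sqrt3}+(\frac1{\sqrt3}-\frac23)T_{k-1}\}$, - $\omega_{D_k}=\{(x,y)\in\Omega:\ y<-\frac{T_k}{2\sqrt3},\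 y<-\frac{x}{\sqrt3}-\frac{T_k}3$, and, if $k\ge1$, also $x>(\frac12-\frac1{\sqrt3})T_{k-1},\ y>\sqrt3x+(1-\frac2{\sqrt3})T_{k-1}\}$. These cells are open, nonempty, pairwise disjoint subsets of $\Omega$, and cover $\Omega$ up to a Lebesgue null set. Except for $\omega_{B_0},\omega_{C_0},\omega_{D_0}$, each of them is the interior of a kite. They are self-similar: with $\rho_\theta$ the counter-clockwise rotation by $\theta$, for all $k\ge0$, $$\omega_{A_k}=t^{2k}\omega_{A_0},\quad \omega_{B_{k+1}}=t\,\rho_{\pi/3}\,\omega_{A_k},\quad \omega_{F_k}=\rho_{-2\pi/3}\,\omega_{A_k},\quad \omega_{E_k}=\rho_{-2\pi/3}\,\omega_{F_k},\quad \omega_{C_k}=\rho_{-2\pi/3}\,\omega_{B_k},\quad \omega_{D_k}=\rho_{-2\pi/3}\,\omega_{C_k}.$$ They accumulate at the origin: every neighbourhood of the origin contains all the cells of level $k$ for all sufficiently large $k$. **Displacement.** Let $v_{o,k}=L\,(\sqrt3-2,\,1)\sum_{j=1}^{k}t^{2j-2}$ and - $v_{A_k}=\big(-\frac x2+(2k-\frac12)\sqrt3y,\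 -\sqrt3x(\frac12+2k)+\frac y2+T_k\big)$, - $v_{B_k}=\big(x+(2k-1)\sqrt3y+\frac{T_k}2,\ (1-2k)\sqrt3x-y+\frac{2+\sqrt3}2T_k\big)$, - $v_{C_k}=\big(-\frac x2+(2k-\frac12)\sqrt3y,\ (\frac32-2k)\sqrt3x+\frac y2\big)$, - $v_{D_k}=\big(-\frac x2+(2k-\frac32)\sqrt3y-\frac{1+\sqrt3}2T_k,\ (\frac12-2k)\sqrt3x+\frac y2+\frac{1+\sqrt3}2T_k\big)$, - $v_{E_k}=\big(-\frac x2+(2k+\frac12)\sqrt3y+\frac{1-\sqrt3}2T_k,\ (\frac12-2k)\sqrt3x+\frac y2+\frac{1+\sqrt3}2T_k\big)$, - $v_{F_k}=\big(x+2k\sqrt3y-\frac{T_k}2,\ -2k\sqrt3x-y+\frac{\sqrt3}2T_k\big)$. Then there is a map $u:\overline\Omega\to\mathbb R^2$ such that $u=\varepsilon(v_{X_k}+v_{o,k})$ on $\omega_{X_k}$ for every $k\ge0$ and $X\in\{A,B,C,D,E,F\}$, $u(0,0)=\frac{\varepsilon L}{1-t^2}(\sqrt3-2,1)$, and 1. $u$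 is continuous on $\overline\Omega$, including at the origin; 2. for almost every point of $\Omega$, $u$ is differentiable there and $(\nabla u)_{sym}\in\{E_1,E_2,E_3\}$; 3. for each $i=1,2,3$, the set of points of $\Omega$ at which $u$ is differentiable with $(\nabla u)_{sym}=E_i$ has area $\frac{\pi}{3}R^2$; 4. the pointwise gradient $\nabla u$ is the weak gradient of $u$ on $\Omega$, and $u\in W^{1,p}(\Omega,\mathbb R^2)$ for every $1\le p<\infty$, but $u$ is not Lipschitz continuous on $\Omega$. Moreover the skew part of $\nabla u$ grows linearly in the nesting level: there are constants $c_1,c_2>0$, independent of $k$, such that for all $k\ge1$, at every point of every cell of level $k$ and for $i\ne j$, $c_1k\le|((\nabla u)_{skew})_{ij}|\le c_2k$. -/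

import Mathlib

open MeasureTheory Topology
open scoped ContDiff ENNReal

noncomputable section

namespace Tripole

/-- The Euclidean plane, with coordinates `x = z 0` and `y = z 1`. -/
abbrev Plane : Type := EuclideanSpace ℝ (Fin 2)

/-! ### Gradients, strains and Sobolev spaces -/

/-- The displacement gradient `(∇u)ᵢⱼ = ∂uᵢ/∂xⱼ` (meaningful where `u` is differentiable). -/
def grad (u : Plane → Plane) (z : Plane) : Matrix (Fin 2) (Fin 2) ℝ :=
  Matrix.of fun i j => fderiv ℝ u z (EuclideanSpace.single j (1 : ℝ)) i

/-- Symmetric part of a matrix. -/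
def symPart (M : Matrix (Fin 2) (Fin 2) ℝ) : Matrix (Fin 2) (Fin 2) ℝ :=
  (1 / 2 : ℝ) • (M + M.transpose)

/-- Skew-symmetric part of a matrix. -/
def skewPart (M : Matrix (Fin 2) (Fin 2) ℝ) : Matrix (Fin 2) (Fin 2) ℝ :=
  (1 / 2 : ℝ) • (M - M.transpose)

/-- The three strains `E₁, E₂, E₃` (indexed by `0, 1, 2`). -/
def strain (ε : ℝ) : Fin 3 → Matrix (Fin 2) (Fin 2) ℝ :=
  ![ε • !![1, 0; 0, -1],
    ε • !![-1 / 2, √3 / 2; √3 / 2, 1 / 2],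
    ε • !![-1 / 2, -√3 / 2; -√3 / 2, 1 / 2]]

/-- The set of points of `Ω` at which `u` is differentiable and `(∇u)_sym` is the strain `i`. -/
def phase (ε : ℝ) (Ω : Set Plane) (u : Plane → Plane) (i : Fin 3) : Set Plane :=
  {z | z ∈ Ω ∧ DifferentiableAt ℝ u z ∧ symPart (grad u z) = strain ε i}

/-- `G` is the weak (distributional) gradient of `u` on the open set `Ω`. -/
def IsWeakGradient (Ω : Set Plane) (u : Plane → Plane)
    (G : Plane → Matrix (Fin 2) (Fin 2) ℝ) : Prop :=
  (∀ i, LocallyIntegrableOn (fun z => u z i) Ω) ∧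
  (∀ i j, LocallyIntegrableOn (fun z => G z i j) Ω) ∧
  ∀ φ : Plane → ℝ, ContDiff ℝ ∞ φ → HasCompactSupport φ → tsupport φ ⊆ Ω →
    ∀ i j, ∫ z in Ω, u z i * fderiv ℝ φ z (EuclideanSpace.single j (1 : ℝ)) =
      -∫ z in Ω, φ z * G z i j

/-- `u ∈ W^{1,p}(Ω, ℝ²)`. -/
def MemSobolev (Ω : Set Plane) (u : Plane → Plane) (p : ℝ≥0∞) : Prop :=
  (∀ i, MemLp (fun z => u z i) p (volume.restrict Ω)) ∧
  ∃ G : Plane → Matrix (Fin 2) (Fin 2) ℝ, IsWeakGradient Ω u G ∧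
    ∀ i j, MemLp (fun z => G z i j) p (volume.restrict Ω)

/-! ### Geometry of the microstructure -/

/-- The radius `R = L √(2/3 + 1/√3)`. -/
def radius (L : ℝ) : ℝ := L * √(2 / 3 + 1 / √3)

/-- The domain `Ω`: the open disk of radius `R` centred at the origin. -/
def disk (L : ℝ) : Set Plane := Metric.ball 0 (radius L)

/-- The contraction factor `t = tan (π/12)`. -/
def t : ℝ := Real.tan (Real.pi / 12)

/-- The six families of cells. -/
inductive Cell : Type
  | A | B | C | D | E | F

/-- The cell of family `X` and nesting level `k`. The outermost cells of the families `B`, `C`, `D`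
are bounded by two lines and the circle; every other cell is bounded by four lines. -/
def cell (L : ℝ) : ℕ → Cell → Set Plane
  | k, .A => {z | z ∈ disk L ∧ z 1 < √3 * z 0 + L / √3 * t ^ (2 * k) ∧
      z 0 < L / (2 * √3) * t ^ (2 * k) ∧
      z 1 > -(1 / √3) * z 0 + (2 / 3 - 1 / √3) * L * t ^ (2 * k) ∧
      z 1 > (1 / √3 - 1 / 2) * L * t ^ (2 * k)}
  | 0, .B => {z | z ∈ disk L ∧ z 1 > √3 * z 0 + L / √3 ∧ z 1 > (1 / √3) * z 0 + L / 3}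
  | k + 1, .B => {z | z ∈ disk L ∧ z 1 > √3 * z 0 + L / √3 * t ^ (2 * (k + 1)) ∧
      z 1 > (1 / √3) * z 0 + L / 3 * t ^ (2 * (k + 1)) ∧
      z 1 < -(1 / √3) * z 0 + (2 / 3 - 1 / √3) * L * t ^ (2 * k) ∧
      z 1 > -√3 * z 0 + (1 - 2 / √3) * L * t ^ (2 * k)}
  | 0, .C => {z | z ∈ disk L ∧ z 1 > -√3 * z 0 + L / √3 ∧ z 0 > L / (2 * √3)}
  | k + 1, .C => {z | z ∈ disk L ∧ z 1 > -√3 * z 0 + L / √3 * t ^ (2 * (k + 1)) ∧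
      z 0 > L / (2 * √3) * t ^ (2 * (k + 1)) ∧
      z 1 < (1 / √3 - 1 / 2) * L * t ^ (2 * k) ∧
      z 1 > (1 / √3) * z 0 + (1 / √3 - 2 / 3) * L * t ^ (2 * k)}
  | 0, .D => {z | z ∈ disk L ∧ z 1 < -(L / (2 * √3)) ∧ z 1 < -(1 / √3) * z 0 - L / 3}
  | k + 1, .D => {z | z ∈ disk L ∧ z 1 < -(L / (2 * √3)) * t ^ (2 * (k + 1)) ∧
      z 1 < -(1 / √3) * z 0 - L / 3 * t ^ (2 * (k + 1)) ∧
      z 0 > (1 / 2 - 1 / √3) * L * t ^ (2 * k) ∧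
      z 1 > √3 * z 0 + (1 - 2 / √3) * L * t ^ (2 * k)}
  | k, .E => {z | z ∈ disk L ∧ z 1 > -(L / (2 * √3)) * t ^ (2 * k) ∧
      z 1 < (1 / √3) * z 0 + L / 3 * t ^ (2 * k) ∧
      z 1 < -√3 * z 0 + (1 - 2 / √3) * L * t ^ (2 * k) ∧
      z 0 < (1 / 2 - 1 / √3) * L * t ^ (2 * k)}
  | k, .F => {z | z ∈ disk L ∧ z 1 < -√3 * z 0 + L / √3 * t ^ (2 * k) ∧
      z 1 > -(1 / √3) * z 0 - L / 3 * t ^ (2 * k) ∧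
      z 1 < (1 / √3) * z 0 + (1 / √3 - 2 / 3) * L * t ^ (2 * k) ∧
      z 1 < √3 * z 0 + (1 - 2 / √3) * L * t ^ (2 * k)}

/-- `S` is the interior of a (nondegenerate, convex) kite `p q r q'`: the vertices `p ≠ r` are
equidistant from `q` and `q'`, and the diagonal `p r` meets the diagonal `q q'` at its midpoint,
strictly between `p` and `r`. -/
def IsOpenKite (S : Set Plane) : Prop :=
  ∃ p q r q' : Plane, p ≠ r ∧ q ≠ q' ∧ dist p q = dist p q' ∧ dist r q = dist r q' ∧
    midpoint ℝ q q' ∈ openSegment ℝ p r ∧ S = interior (convexHull ℝ {p, q, r, q'})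

/-- Counter-clockwise rotation of the plane by the angle `θ`. -/
def rot (θ : ℝ) (z : Plane) : Plane :=
  !₂[Real.cos θ * z 0 - Real.sin θ * z 1, Real.sin θ * z 0 + Real.cos θ * z 1]

/-- The self-similarity relations between the cells. -/
def SelfSimilar (L : ℝ) : Prop :=
  ∀ k : ℕ,
    cell L k .A = (fun z => t ^ (2 * k) • z) '' cell L 0 .A ∧
    cell L (k + 1) .B = (fun z => t • rot (Real.pi / 3) z) '' cell L k .A ∧
    cell L k .F = rot (-(2 * Real.pi / 3)) '' cell L k .A ∧
    cell L k .E = rot (-(2 * Real.pi / 3)) '' cell L k .F ∧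
    cell L k .C = rot (-(2 * Real.pi / 3)) '' cell L k .B ∧
    cell L k .D = rot (-(2 * Real.pi / 3)) '' cell L k .C

/-! ### The displacement on each cell -/

/-- The affine maps, one for each cell. -/
def v (L : ℝ) (k : ℕ) : Cell → Plane → Plane
  | .A, z => !₂[-(z 0) / 2 + (2 * k - 1 / 2) * √3 * z 1,
      -√3 * z 0 * (1 / 2 + 2 * k) + z 1 / 2 + L * t ^ (2 * k)]
  | .B, z => !₂[z 0 + (-√3 + 2 * k * √3) * z 1 + L * (t ^ (2 * k) / 2),
      z 0 * (√3 - 2 * k * √3) - z 1 + t ^ (2 * k) / 2 * (2 + √3) * L]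
  | .C, z => !₂[-(z 0) / 2 + √3 * z 1 * (2 * k - 1 / 2),
      3 * √3 / 2 * z 0 - 2 * k * √3 * z 0 + z 1 / 2]
  | .D, z => !₂[-(z 0) / 2 + 2 * k * √3 * z 1 - 3 * √3 / 2 * z 1
        - t ^ (2 * k) * (1 / 2 + √3 / 2) * L,
      (√3 / 2 - 2 * k * √3) * z 0 + z 1 / 2 + t ^ (2 * k) * ((1 + √3) / 2) * L]
  | .E, z => !₂[-(z 0) / 2 + (1 / 2 + 2 * k) * √3 * z 1 + t ^ (2 * k) * (1 / 2 - √3 / 2) * L,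
      (1 / 2 - 2 * k) * √3 * z 0 + z 1 / 2 + t ^ (2 * k) * (1 / 2 + √3 / 2) * L]
  | .F, z => !₂[z 0 + 2 * √3 * k * z 1 - 1 / 2 * t ^ (2 * k) * L,
      -2 * k * √3 * z 0 - z 1 + t ^ (2 * k) * (√3 / 2) * L]

/-- The translations `L (√3 - 2, 1) ∑_{j=1}^k t^{2j-2}`, one for each nesting level. -/
def shift (L : ℝ) (k : ℕ) : Plane :=
  (L * ∑ j ∈ Finset.range k, t ^ (2 * j)) • !₂[√3 - 2, 1]

end Tripole

end

noncomputable section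

namespace Tripole

/-! ### The contraction factor -/

/-! The geometry becomes uniform in six frames, each rotated by π/3 from the last, with coordinates
`X j`, `Y j`. The rays at angles 5π/12 + jπ/3 cut the plane into six sectors. Each cell is the part
in the disk of a `kite` of ring n whose axis lies on ray j, with n + j odd, and the edges are the
lines `X j = thr L n` and `Y j = thr L n`, where `thr L n` is geometric of ratio t. Inside sector j
the pattern is a staircase: a kite on ray j is cut out by `X j < thr L n` and `thr L (n + 1) < Y j`,
and a kite on the previous ray by the same conditions with X and Y exchanged. Disjointness, covering
and self-similarity follow from this description (`cell_eq`, `mem_kite_left`, `mem_kite_right`,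
`exists_mem_kite`).

The displacement is built sector by sector rather than cell by cell. In the frame of sector j it is
the affine map of the outermost cell plus 2√3 (-P(Y), Q(X)), where P and Q are instances of
`profile`: sums of positive parts of threshold minus argument, over every second threshold. Crossing
a line X = const or Y = const therefore changes the gradient by a rank-one off-diagonal matrix. If m
thresholds lie above X and m' above Y, the correction has symmetric part proportional to m' - m,
which takes only the values 0 and -1, and skew part proportional to m' + m, which grows with the
ring. This gives few strains but unbounded rotations. The profile series converges uniformly, so
there is no difficulty at the origin, and two functional equations under s ↦ ts (`profile_one_mul`,
`profile_zero_mul`) make neighbouring sectors agree on their common ray (`sectorMap_succ`). Counting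
thresholds recovers the prescribed affine maps on the cells (`disp_eq_of_mem_cell`).

Rotation by -2π/3 permutes the three strains, whence equal areas. Level k has area of order t^(4k)
and gradient of order k, whence all finite p. For the weak gradient, u times a test function
vanishing near the origin is a continuous selection of finitely many Lipschitz functions, hence
Lipschitz, and integration by parts applies. A cutoff at scale 1/n then removes the origin: its
gradient is of order n on an area of order 1/n², and u is bounded. Unbounded rotations exclude a
Lipschitz bound. -/

lemma sqrt_three_mul_self : √3 * √3 = (3 : ℝ) := Real.mul_self_sqrt (by norm_num)

lemma sqrt_three_pos : (0 : ℝ) < √3 := by positivity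

lemma one_div_sqrt_three : 1 / √3 = √3 / (3 : ℝ) := by
  have := sqrt_three_mul_self
  have := sqrt_three_pos
  grind

lemma t_eq : t = 2 - √3 := by
  have h1 : Real.sin (2 * (Real.pi / 12)) = 1 / 2 := by
    rw [show 2 * (Real.pi / 12) = Real.pi / 6 by ring, Real.sin_pi_div_six]
  have h2 : Real.cos (2 * (Real.pi / 12)) = √3 / 2 := by
    rw [show 2 * (Real.pi / 12) = Real.pi / 6 by ring, Real.cos_pi_div_six]
  rw [Real.sin_two_mul] at h1
  rw [Real.cos_two_mul] at h2
  have hc : Real.cos (Real.pi / 12) ≠ 0 := by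
    intro h
    rw [h] at h1
    norm_num at h1
  have h3 := sqrt_three_mul_self
  have h4 := sqrt_three_pos
  rw [t, Real.tan_eq_sin_div_cos, div_eq_iff hc]
  -- The double-angle values give sin cos = 1/4 and cos² = (2 + √3)/4, so both terms of the expanded
  -- product equal 1/4.
  have : Real.cos (Real.pi / 12) * (Real.sin (Real.pi / 12)
      - (2 - √3) * Real.cos (Real.pi / 12)) = 0 := by
    grind
  rcases mul_eq_zero.1 this with h | h
  · exact absurd h hc
  · linarith

lemma sqrt_three_eq : √3 = 2 - t := by rw [t_eq]; ring

/-- The minimal polynomial of t. Together with √3 = 2 - t it reduces every later identity to one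
that is linear in t. -/
lemma t_sq : t * t = 4 * t - 1 := by
  have := sqrt_three_mul_self
  rw [t_eq]; linarith

lemma t_pos : 0 < t := by
  have := sqrt_three_mul_self
  have := sqrt_three_pos
  rw [t_eq]; nlinarith

lemma t_lt_half : t < 1 / 2 := by
  have := t_sq
  have := t_pos
  have := sqrt_three_pos
  rw [sqrt_three_eq] at this
  nlinarith

lemma t_lt_one : t < 1 := by linarith [t_lt_half]

/-! ### Rotated coordinates -/

/-- Cosines of the multiples of `π / 3`. -/
def cosTab : Fin 6 → ℝ := ![1, 1 / 2, -1 / 2, -1, -1 / 2, 1 / 2]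

/-- Sines of the multiples of `π / 3`. -/
def sinTab : Fin 6 → ℝ := ![0, √3 / 2, √3 / 2, 0, -√3 / 2, -√3 / 2]

/-- First coordinate in the frame rotated by `j π / 3`. -/
def X (j : Fin 6) (z : Plane) : ℝ := cosTab j * z 0 + sinTab j * z 1

/-- Second coordinate in the frame rotated by `j π / 3`. -/
def Y (j : Fin 6) (z : Plane) : ℝ := -sinTab j * z 0 + cosTab j * z 1

lemma X_succ (j : Fin 6) (z : Plane) : X (j + 1) z = X j z / 2 + √3 / 2 * Y j z := by
  have := sqrt_three_mul_self
  fin_cases j <;> simp [X, Y, cosTab, sinTab] <;> grind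

lemma Y_succ (j : Fin 6) (z : Plane) : Y (j + 1) z = -(√3 / 2) * X j z + Y j z / 2 := by
  have := sqrt_three_mul_self
  fin_cases j <;> simp [X, Y, cosTab, sinTab] <;> grind

lemma X_sq_add_Y_sq (j : Fin 6) (z : Plane) : X j z ^ 2 + Y j z ^ 2 = z 0 ^ 2 + z 1 ^ 2 := by
  have := sqrt_three_mul_self
  fin_cases j <;> simp [X, Y, cosTab, sinTab] <;> grind

lemma norm_sq_eq (z : Plane) : ‖z‖ ^ 2 = z 0 ^ 2 + z 1 ^ 2 := by
  simp [EuclideanSpace.norm_sq_eq, Fin.sum_univ_two]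

lemma norm_sq_eq_frame (j : Fin 6) (z : Plane) : ‖z‖ ^ 2 = X j z ^ 2 + Y j z ^ 2 := by
  rw [norm_sq_eq, X_sq_add_Y_sq]

lemma continuous_X (j : Fin 6) : Continuous (X j) := by unfold X; fun_prop

lemma continuous_Y (j : Fin 6) : Continuous (Y j) := by unfold Y; fun_prop

/-- The signed distance (up to a constant) from the ray at angle `5π/12 + jπ/3`. -/
def side (j : Fin 6) (z : Plane) : ℝ := X j z - t * Y j z

lemma side_eq_succ (j : Fin 6) (z : Plane) : side j z = t * X (j + 1) z - Y (j + 1) z := by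
  rw [side, X_succ, Y_succ, sqrt_three_eq]
  linear_combination (Y j z / 2) * t_sq

/-- The normals of the rays turn by π/3 at each step, so they obey the recurrence of a primitive
sixth root of unity, ω² = ω - 1. -/
lemma side_add_two (j : Fin 6) (z : Plane) : side (j + 2) z = side (j + 1) z - side j z := by
  have h : j + 2 = j + 1 + 1 := by rw [add_assoc]; rfl
  have := sqrt_three_mul_self
  rw [h]
  simp only [side, X_succ, Y_succ, sqrt_three_eq]
  rw [sqrt_three_eq] at this
  grind

lemma side_add_three (j : Fin 6) (z : Plane) : side (j + 3) z = -side j z := by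
  have h : j + 3 = j + 1 + 2 := by rw [add_assoc]; rfl
  have h' : j + 1 + 1 = j + 2 := by rw [add_assoc]; rfl
  rw [h, side_add_two, h', side_add_two]
  ring

/-- The closed sector of angles between `π/12 + jπ/3` and `5π/12 + jπ/3`. -/
def sector (j : Fin 6) : Set Plane := {z | 0 ≤ side j z ∧ side (j + 5) z ≤ 0}

lemma side_add_five (j : Fin 6) (z : Plane) : side (j + 5) z = t * X j z - Y j z := by
  rw [side_eq_succ]
  have h : j + 5 + 1 = j := by rw [add_assoc]; exact add_zero j
  rw [h]

lemma mem_sector {j : Fin 6} {z : Plane} :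
    z ∈ sector j ↔ t * Y j z ≤ X j z ∧ t * X j z ≤ Y j z := by
  rw [sector, Set.mem_ofPred_eq, side_add_five, side]
  constructor <;> rintro ⟨h1, h2⟩ <;> constructor <;> linarith

lemma mem_sector_succ {j : Fin 6} {z : Plane} :
    z ∈ sector (j + 1) ↔ 0 ≤ side (j + 1) z ∧ side j z ≤ 0 := by
  have h : j + 1 + 5 = j := by rw [add_assoc]; exact add_zero j
  rw [sector, Set.mem_ofPred_eq, h]

lemma isClosed_sector (j : Fin 6) : IsClosed (sector j) := by
  have h : ∀ i, Continuous (side i) := fun i => by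
    unfold side
    exact (continuous_X i).sub (continuous_const.mul (continuous_Y i))
  exact (isClosed_le continuous_const (h _)).inter (isClosed_le (h _) continuous_const)

/-- If no sector contained z, nonnegativity of one `side` would force positivity of the preceding
one, hence of all six around the cycle. But opposite sides are negatives of each other. -/
lemma exists_mem_sector (z : Plane) : ∃ j, z ∈ sector j := by
  have h2 := side_add_two 0 z
  have h3 := side_add_three 0 z
  have h4 := side_add_three 1 z
  have h5 := side_add_three 2 z
  by_contra! h
  simp only [sector, Set.mem_ofPred_eq, not_and, not_le] at h
  have k0 := h 0
  have k1 := h 1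
  have k2 := h 2
  have k3 := h 3
  have k4 := h 4
  have k5 := h 5
  simp only [Fin.isValue, Fin.reduceAdd, zero_add] at *
  grind

lemma nonneg_of_mem_sector {j : Fin 6} {z : Plane} (h : z ∈ sector j) : 0 ≤ X j z ∧ 0 ≤ Y j z := by
  rw [mem_sector] at h
  have h0 := t_pos
  have h1 := t_lt_half
  have h2 := t_sq
  have hx := mul_le_mul_of_nonneg_left h.2 h0.le
  have hy := mul_le_mul_of_nonneg_left h.1 h0.le
  constructor
  · by_contra! hneg
    nlinarith [mul_pos_of_neg_of_neg hneg (by linarith : t * t - 1 < 0)]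
  · by_contra! hneg
    nlinarith [mul_pos_of_neg_of_neg hneg (by linarith : t * t - 1 < 0)]

/-! ### Kites -/

/-- The thresholds of the microstructure. -/
def thr (L : ℝ) (n : ℕ) : ℝ := L * (2 + √3) / (2 * √3) * t ^ n

lemma thr_succ (L : ℝ) (n : ℕ) : thr L (n + 1) = t * thr L n := by
  rw [thr, thr]; ring

lemma thr_pos {L : ℝ} (hL : 0 < L) (n : ℕ) : 0 < thr L n := by
  have := t_pos
  unfold thr; positivity

lemma thr_strictAnti {L : ℝ} (hL : 0 < L) : StrictAnti (thr L) :=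
  strictAnti_nat_of_succ_lt fun n => by
    rw [thr_succ]
    nlinarith [thr_pos hL n, t_lt_one]

lemma thr_one (L : ℝ) : thr L 1 = L / (2 * √3) := by
  have := sqrt_three_mul_self
  have := sqrt_three_pos
  rw [thr, t_eq]
  grind

lemma thr_odd (L : ℝ) (k : ℕ) : thr L (2 * k + 1) = L * √3 / 6 * t ^ (2 * k) := by
  have h : thr L (2 * k + 1) = thr L 1 * t ^ (2 * k) := by
    simp only [thr]; ring
  have := sqrt_three_mul_self
  have := sqrt_three_pos
  rw [h, thr_one]
  grind

lemma thr_even (L : ℝ) (k : ℕ) : thr L (2 * k + 2) = L * (√3 / 3 - 1 / 2) * t ^ (2 * k) := by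
  have := sqrt_three_mul_self
  rw [thr_succ, thr_odd, t_eq]
  grind

/-- The open kite of ring `n` on the ray at angle `5π/12 + jπ/3`. -/
def kite (L : ℝ) (n : ℕ) (j : Fin 6) : Set Plane :=
  {z | X j z < thr L n ∧ thr L (n + 1) < Y j z ∧ thr L (n + 1) < X (j + 1) z ∧
    Y (j + 1) z < thr L n}

/-- The ring of a cell. -/
def ring (k : ℕ) : Cell → ℕ
  | .A => 2 * k + 1
  | .B => 2 * k
  | .C => 2 * k
  | .D => 2 * k
  | .E => 2 * k + 1
  | .F => 2 * k + 1

/-- The ray of a cell. -/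
def ray : Cell → Fin 6
  | .A => 0
  | .B => 1
  | .C => 5
  | .D => 3
  | .E => 2
  | .F => 4

/-- The circle passes through the outer tips of the kites of ring 1, which have frame coordinates
`thr L 1` and `(2 + √3) * thr L 1`. -/
lemma radius_sq (L : ℝ) : radius L ^ 2 = thr L 1 ^ 2 * (1 + (2 + √3) ^ 2) := by
  have := sqrt_three_mul_self
  have := sqrt_three_pos
  rw [radius, mul_pow, Real.sq_sqrt (by positivity), thr_one]
  grind

lemma radius_pos {L : ℝ} (hL : 0 < L) : 0 < radius L := by
  unfold radius; positivity

lemma mem_disk {L : ℝ} (hL : 0 < L) {z : Plane} (j : Fin 6) :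
    z ∈ disk L ↔ X j z ^ 2 + Y j z ^ 2 < radius L ^ 2 := by
  rw [disk, mem_ball_zero_iff, ← norm_sq_eq_frame,
    pow_lt_pow_iff_left₀ (norm_nonneg _) (radius_pos hL).le two_ne_zero]

/-- Since 1/t = 2 + √3, the square of `thr L 0` is exactly the squared radius minus that of `thr L
1`. This supplies the two kite inequalities absent from the outermost cells. -/
lemma lt_thr_zero_of_mem_disk {L : ℝ} (hL : 0 < L) {z : Plane} (hz : z ∈ disk L) (j : Fin 6) :
    (thr L 1 < Y j z → X j z < thr L 0) ∧ (thr L 1 < X j z → Y j z < thr L 0) := by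
  rw [mem_disk hL j, radius_sq] at hz
  have h0 : thr L 0 = (2 + √3) * thr L 1 := by
    rw [thr_succ, t_eq]
    linear_combination (thr L 0) * sqrt_three_mul_self
  have h1 := thr_pos hL 1
  have h2 := thr_pos hL 0
  constructor <;> intro h <;> rw [h0] at h2 ⊢ <;> refine lt_of_pow_lt_pow_left₀ 2 h2.le ?_ <;> nlinarith

lemma frame_eq (z : Plane) :
    (X 0 z = z 0 ∧ X 1 z = z 0 / 2 + √3 / 2 * z 1 ∧ X 2 z = -z 0 / 2 + √3 / 2 * z 1 ∧
      X 3 z = -z 0 ∧ X 4 z = -z 0 / 2 - √3 / 2 * z 1 ∧ X 5 z = z 0 / 2 - √3 / 2 * z 1) ∧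
    (Y 0 z = z 1 ∧ Y 1 z = -(√3 / 2) * z 0 + z 1 / 2 ∧ Y 2 z = -(√3 / 2) * z 0 - z 1 / 2 ∧
      Y 3 z = -z 1 ∧ Y 4 z = √3 / 2 * z 0 - z 1 / 2 ∧ Y 5 z = √3 / 2 * z 0 + z 1 / 2) := by
  simp only [X, Y, cosTab, sinTab]
  refine ⟨⟨?_, ?_, ?_, ?_, ?_, ?_⟩, ?_, ?_, ?_, ?_, ?_, ?_⟩ <;> simp <;> ring

set_option maxHeartbeats 800000 in
lemma cell_zero_eq_of_ring_pos (L : ℝ) (c : Cell) (hc : 0 < ring 0 c) :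
    cell L 0 c = disk L ∩ kite L (ring 0 c) (ray c) := by
  have h1 := sqrt_three_mul_self
  have h2 := sqrt_three_pos
  have h3 := one_div_sqrt_three
  have h4 : L / √3 = L * √3 / 3 := by grind
  have h5 : L / (2 * √3) = L * √3 / 6 := by grind
  have h6 : 2 / √3 = 2 * √3 / 3 := by grind
  ext z
  obtain ⟨⟨x0, x1, x2, x3, x4, x5⟩, y0, y1, y2, y3, y4, y5⟩ := frame_eq z
  have q0 : √3 * √3 * z 0 = 3 * z 0 := by rw [h1]
  have q1 : √3 * √3 * z 1 = 3 * z 1 := by rw [h1]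
  have q2 : √3 * √3 * L = 3 * L := by rw [h1]
  have r0 := thr_odd L 0
  have r1 := thr_even L 0
  simp only [mul_zero, zero_add, pow_zero, mul_one] at r0 r1
  cases c <;> simp only [ring, mul_zero, lt_irrefl] at hc <;>
    simp only [cell, kite, ring, ray, Set.mem_ofPred_eq, Set.mem_inter_iff, gt_iff_lt,
      h3, h4, h5, h6, mul_zero, zero_add, pow_zero, mul_one, r0, r1, Fin.isValue,
      Fin.reduceAdd, x0, x1, x2, x3, x4, x5, y0, y1, y2, y3, y4, y5] <;>
    refine and_congr_right fun _ => ⟨?_, ?_⟩ <;> rintro ⟨i1, i2, i3, i4⟩ <;>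
    -- The equations of a cell and of a kite differ by rational multiples of 1 or √3. With the
    -- √3-multiples of the inequalities at hand, the comparison is linear.
    have j1 := mul_lt_mul_of_pos_left i1 h2 <;> have j2 := mul_lt_mul_of_pos_left i2 h2 <;>
    have j3 := mul_lt_mul_of_pos_left i3 h2 <;> have j4 := mul_lt_mul_of_pos_left i4 h2 <;>
    refine ⟨?_, ?_, ?_, ?_⟩ <;> linarith

set_option maxHeartbeats 1600000 in
lemma cell_succ_eq (L : ℝ) (k : ℕ) (c : Cell) :
    cell L (k + 1) c = disk L ∩ kite L (ring (k + 1) c) (ray c) := by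
  have h1 := sqrt_three_mul_self
  have h2 := sqrt_three_pos
  have h3 := one_div_sqrt_three
  have h4 : L / √3 = L * √3 / 3 := by grind
  have h5 : L / (2 * √3) = L * √3 / 6 := by grind
  have h6 : 2 / √3 = 2 * √3 / 3 := by grind
  ext z
  obtain ⟨⟨x0, x1, x2, x3, x4, x5⟩, y0, y1, y2, y3, y4, y5⟩ := frame_eq z
  have q0 : √3 * √3 * z 0 = 3 * z 0 := by rw [h1]
  have q1 : √3 * √3 * z 1 = 3 * z 1 := by rw [h1]
  have q2 (n : ℕ) : √3 * √3 * (L * t ^ n) = 3 * (L * t ^ n) := by rw [h1]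
  have q3 := q2 (2 * k)
  have q4 := q2 (2 * k + 2)
  have r1 := thr_even L k
  have r2 := thr_odd L (k + 1)
  have r3 := thr_even L (k + 1)
  simp only [Nat.mul_add, mul_one] at r2 r3
  cases c <;>
    simp only [cell, kite, ring, ray, Set.mem_ofPred_eq, Set.mem_inter_iff, gt_iff_lt,
      h3, h4, h5, h6, Nat.mul_add, mul_one, r1, r2, r3, Fin.isValue,
      Fin.reduceAdd, x0, x1, x2, x3, x4, x5, y0, y1, y2, y3, y4, y5] <;>
    refine and_congr_right fun _ => ⟨?_, ?_⟩ <;> rintro ⟨i1, i2, i3, i4⟩ <;>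
    have j1 := mul_lt_mul_of_pos_left i1 h2 <;> have j2 := mul_lt_mul_of_pos_left i2 h2 <;>
    have j3 := mul_lt_mul_of_pos_left i3 h2 <;> have j4 := mul_lt_mul_of_pos_left i4 h2 <;>
    refine ⟨?_, ?_, ?_, ?_⟩ <;> linarith

lemma cell_zero_eq_of_ring_zero {L : ℝ} (hL : 0 < L) (c : Cell) (hc : ring 0 c = 0) :
    cell L 0 c = disk L ∩ kite L (ring 0 c) (ray c) := by
  have h1 := sqrt_three_mul_self
  have h2 := sqrt_three_pos
  have h3 := one_div_sqrt_three
  have h4 : L / √3 = L * √3 / 3 := by grind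
  have h5 : L / (2 * √3) = L * √3 / 6 := by grind
  ext z
  obtain ⟨⟨x0, x1, x2, x3, x4, x5⟩, y0, y1, y2, y3, y4, y5⟩ := frame_eq z
  have q0 : √3 * √3 * z 0 = 3 * z 0 := by rw [h1]
  have q1 : √3 * √3 * z 1 = 3 * z 1 := by rw [h1]
  have q2 : √3 * √3 * L = 3 * L := by rw [h1]
  have hd := fun hz => lt_thr_zero_of_mem_disk (z := z) hL hz
  have r0 := thr_odd L 0
  simp only [mul_zero, zero_add, pow_zero, mul_one] at r0
  have main (P Q : Prop) (j j' : Fin 6) (hj : j + 1 = j') (hP : P ↔ thr L 1 < Y j z)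
      (hQ : Q ↔ thr L 1 < X j' z) : z ∈ disk L ∧ P ∧ Q ↔ z ∈ disk L ∧ z ∈ kite L 0 j := by
    subst hj
    refine and_congr_right fun hz => ?_
    rw [hP, hQ, kite, Set.mem_ofPred_eq, zero_add]
    exact ⟨fun h => ⟨(hd hz j).1 h.1, h.1, h.2, (hd hz (j + 1)).2 h.2⟩, fun h => ⟨h.2.1, h.2.2.1⟩⟩
  cases c <;> simp only [ring, mul_zero, zero_add, one_ne_zero] at hc <;>
    simp only [cell, ring, ray, Set.mem_ofPred_eq, Set.mem_inter_iff, gt_iff_lt,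
          h3, h4, h5, mul_zero]
  · apply main _ _ 1 2 rfl <;> rw [r0] <;> simp only [x2, y1] <;> constructor <;> intro i <;>
      have j := mul_lt_mul_of_pos_left i h2 <;> linarith
  · apply main _ _ 5 0 rfl <;> rw [r0] <;> simp only [x0, y5] <;> constructor <;> intro i <;>
      have j := mul_lt_mul_of_pos_left i h2 <;> linarith
  · apply main _ _ 3 4 rfl <;> rw [r0] <;> simp only [x4, y3] <;> constructor <;> intro i <;>
      have j := mul_lt_mul_of_pos_left i h2 <;> linarith

lemma cell_eq {L : ℝ} (hL : 0 < L) (k : ℕ) (c : Cell) :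
    cell L k c = disk L ∩ kite L (ring k c) (ray c) := by
  rcases k with _ | k
  · rcases Nat.eq_zero_or_pos (ring 0 c) with h | h
    · exact cell_zero_eq_of_ring_zero hL c h
    · exact cell_zero_eq_of_ring_pos L c h
  · exact cell_succ_eq L k c

lemma X_pred (j : Fin 6) (z : Plane) :
    X j z = X (j + 1) z / 2 - √3 / 2 * Y (j + 1) z := by
  rw [X_succ, Y_succ]
  linear_combination (-X j z / 4) * sqrt_three_mul_self

lemma Y_pred (j : Fin 6) (z : Plane) :
    Y j z = √3 / 2 * X (j + 1) z + Y (j + 1) z / 2 := by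
  rw [X_succ, Y_succ]
  linear_combination (-Y j z / 4) * sqrt_three_mul_self

lemma add_five_add_one (j : Fin 6) : j + 5 + 1 = j := by
  rw [add_assoc]; exact add_zero j

lemma X_smul (j : Fin 6) (c : ℝ) (z : Plane) : X j (c • z) = c * X j z := by
  simp [X]; ring

lemma Y_smul (j : Fin 6) (c : ℝ) (z : Plane) : Y j (c • z) = c * Y j z := by
  simp [Y]; ring

lemma isOpen_kite (L : ℝ) (n : ℕ) (j : Fin 6) : IsOpen (kite L n j) :=
  (isOpen_lt (continuous_X _) continuous_const).inter <|
    (isOpen_lt continuous_const (continuous_Y _)).inter <|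
      (isOpen_lt continuous_const (continuous_X _)).inter <|
        isOpen_lt (continuous_Y _) continuous_const

lemma isOpen_cell {L : ℝ} (hL : 0 < L) (k : ℕ) (c : Cell) : IsOpen (cell L k c) := by
  rw [cell_eq hL]
  exact Metric.isOpen_ball.inter (isOpen_kite _ _ _)

/-! ### Kites and sectors -/

/-- Comparing t · `thr L n` with `thr L (n + 1)` confines the kite strictly between the rays on
either side of its own, that is, to two sectors. -/
lemma side_of_mem_kite {L : ℝ} {n : ℕ} {j : Fin 6} {z : Plane} (h : z ∈ kite L n j) :
    side (j + 5) z < 0 ∧ 0 < side (j + 1) z := by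
  obtain ⟨h1, h2, h3, h4⟩ := h
  rw [thr_succ] at h2 h3
  have h5 := mul_lt_mul_of_pos_left h1 t_pos
  have h6 := mul_lt_mul_of_pos_left h4 t_pos
  rw [side_add_five, side]
  constructor <;> linarith

lemma mem_sector_of_mem_kite {L : ℝ} {n : ℕ} {j : Fin 6} {z : Plane} (h : z ∈ kite L n j) :
    z ∈ sector j ∨ z ∈ sector (j + 1) := by
  obtain ⟨h1, h2⟩ := side_of_mem_kite h
  rw [mem_sector_succ, sector, Set.mem_ofPred_eq]
  rcases le_total 0 (side j z) with h3 | h3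
  · exact Or.inl ⟨h3, h1.le⟩
  · exact Or.inr ⟨h2.le, h3⟩

/-- In this sector the next frame satisfies `X (j + 1) z ≥ Y j z` and `Y (j + 1) z ≤ X j z`, so the
constraints of that frame are redundant. -/
lemma mem_kite_left {L : ℝ} {n : ℕ} {j : Fin 6} {z : Plane} (h : z ∈ sector j) :
    z ∈ kite L n j ↔ X j z < thr L n ∧ thr L (n + 1) < Y j z := by
  refine ⟨fun h' => ⟨h'.1, h'.2.1⟩, fun h' => ⟨h'.1, h'.2, ?_, ?_⟩⟩
  · rw [X_succ, sqrt_three_eq]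
    linarith [(mem_sector.1 h).1, h'.2]
  · rw [Y_succ, sqrt_three_eq]
    have h1 := mul_le_mul_of_nonneg_left (mem_sector.1 h).1
      (by linarith [t_lt_half] : (0 : ℝ) ≤ (2 - t) / 2)
    have h2 : (2 - t) / 2 * (t * Y j z) = Y j z / 2 - t * Y j z := by
      linear_combination (-Y j z / 2) * t_sq
    linarith [(mem_sector.1 h).1, h'.1]

lemma mem_kite_right {L : ℝ} {n : ℕ} {j : Fin 6} {z : Plane} (h : z ∈ sector (j + 1)) :
    z ∈ kite L n j ↔ Y (j + 1) z < thr L n ∧ thr L (n + 1) < X (j + 1) z := by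
  refine ⟨fun h' => ⟨h'.2.2.2, h'.2.2.1⟩, fun h' => ⟨?_, ?_, h'.2, h'.1⟩⟩
  · rw [X_pred, sqrt_three_eq]
    have h1 := mul_le_mul_of_nonneg_left (mem_sector.1 h).2
      (by linarith [t_lt_half] : (0 : ℝ) ≤ (2 - t) / 2)
    have h2 : (2 - t) / 2 * (t * X (j + 1) z) = X (j + 1) z / 2 - t * X (j + 1) z := by
      linear_combination (-X (j + 1) z / 2) * t_sq
    linarith [(mem_sector.1 h).2, h'.1]
  · rw [Y_pred, sqrt_three_eq]
    linarith [(mem_sector.1 h).2, h'.2]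

lemma frame_bound_of_mem_sector {j : Fin 6} {z : Plane} (h : z ∈ sector j) :
    Y j z ≤ (2 + √3) * X j z ∧ X j z ≤ (2 + √3) * Y j z := by
  obtain ⟨h1, h2⟩ := mem_sector.1 h
  have h3 : (0 : ℝ) ≤ 2 + √3 := by positivity
  have h4 : (2 + √3) * t = 1 := by rw [t_eq]; linear_combination -sqrt_three_mul_self
  have h5 := mul_le_mul_of_nonneg_left h1 h3
  have h6 := mul_le_mul_of_nonneg_left h2 h3
  rw [← mul_assoc, h4, one_mul] at h5 h6
  exact ⟨h5, h6⟩

/-- The outer tip is the farthest point of the closed kite: one coordinate is below `thr L n`, and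
the sector bounds the other by 2 + √3 times it. -/
lemma norm_sq_lt_of_mem_kite {L : ℝ} {n : ℕ} {j : Fin 6} {z : Plane} (h : z ∈ kite L n j) :
    ‖z‖ ^ 2 < thr L n ^ 2 * (1 + (2 + √3) ^ 2) := by
  have h3 : (0 : ℝ) ≤ 2 + √3 := by positivity
  have key : ∀ x y : ℝ, 0 ≤ x → 0 ≤ y → x < thr L n → y ≤ (2 + √3) * x →
      x ^ 2 + y ^ 2 < thr L n ^ 2 * (1 + (2 + √3) ^ 2) := by
    intro x y hx hy h1 h2
    have h4 : x ^ 2 < thr L n ^ 2 := pow_lt_pow_left₀ h1 hx two_ne_zero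
    have h5 : y ^ 2 ≤ (2 + √3) ^ 2 * x ^ 2 := by
      rw [← mul_pow]; exact pow_le_pow_left₀ hy h2 2
    have h6 := mul_lt_mul_of_pos_right h4 (by positivity : (0 : ℝ) < 1 + (2 + √3) ^ 2)
    linarith
  rcases mem_sector_of_mem_kite h with hs | hs
  · rw [norm_sq_eq_frame j]
    have h0 := nonneg_of_mem_sector hs
    exact key _ _ h0.1 h0.2 h.1 (frame_bound_of_mem_sector hs).1
  · rw [norm_sq_eq_frame (j + 1), add_comm]
    have h0 := nonneg_of_mem_sector hs
    exact key _ _ h0.2 h0.1 h.2.2.2 (frame_bound_of_mem_sector hs).2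

lemma norm_lt_of_mem_kite {L : ℝ} (hL : 0 < L) {n : ℕ} {j : Fin 6} {z : Plane}
    (h : z ∈ kite L n j) : ‖z‖ < 4 * thr L n := by
  have h1 := norm_sq_lt_of_mem_kite h
  have h2 := thr_pos hL n
  have h3 := t_pos
  refine lt_of_pow_lt_pow_left₀ 2 (by positivity) (h1.trans_le ?_)
  rw [mul_pow, mul_comm]
  refine mul_le_mul_of_nonneg_right ?_ (by positivity)
  rw [t_eq] at h3
  nlinarith [sqrt_three_mul_self, sqrt_three_pos]

lemma kite_subset_disk {L : ℝ} (hL : 0 < L) {n : ℕ} (hn : 1 ≤ n) (j : Fin 6) :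
    kite L n j ⊆ disk L := by
  intro z h
  rw [mem_disk hL j, ← norm_sq_eq_frame, radius_sq]
  refine (norm_sq_lt_of_mem_kite h).trans_le (mul_le_mul_of_nonneg_right ?_ (by positivity))
  exact pow_le_pow_left₀ (thr_pos hL n).le ((thr_strictAnti hL).antitone hn) 2

lemma cell_eq_kite {L : ℝ} (hL : 0 < L) {k : ℕ} {c : Cell} (h : 1 ≤ ring k c) :
    cell L k c = kite L (ring k c) (ray c) := by
  rw [cell_eq hL, Set.inter_eq_right]
  exact kite_subset_disk hL h _

lemma cell_subset_kite {L : ℝ} (hL : 0 < L) (k : ℕ) (c : Cell) :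
    cell L k c ⊆ kite L (ring k c) (ray c) := by
  rw [cell_eq hL]; exact Set.inter_subset_right

lemma cell_subset_disk {L : ℝ} (hL : 0 < L) (k : ℕ) (c : Cell) : cell L k c ⊆ disk L := by
  rw [cell_eq hL]; exact Set.inter_subset_left

/-! ### Disjointness -/

/-- Kites on one ray two or more rings apart can meet at most at tips: a common point would lie
strictly on both sides of the ray. -/
lemma disjoint_kite_self {L : ℝ} (hL : 0 < L) {n m : ℕ} (h : n + 2 ≤ m) (j : Fin 6) :
    Disjoint (kite L n j) (kite L m j) := by
  refine Set.disjoint_left.2 fun z hz hz' => ?_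
  have h1 : thr L m ≤ t * (t * thr L n) := by
    rw [← thr_succ, ← thr_succ]; exact (thr_strictAnti hL).antitone h
  have h2 := mul_lt_mul_of_pos_left hz.2.1 t_pos
  have h3 := mul_lt_mul_of_pos_left hz.2.2.1 t_pos
  rw [thr_succ] at h2 h3
  have h4 : side j z < 0 := by rw [side]; linarith [hz'.1]
  have h5 : 0 < side j z := by rw [side_eq_succ]; linarith [hz'.2.2.2]
  exact lt_asymm h4 h5

/-- In the shared frame `j + 1`, a common point forces m < n + 1 and n < m + 1. Equal rings on
adjacent rays are excluded later by parity. -/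
lemma disjoint_kite_succ {L : ℝ} (hL : 0 < L) {n m : ℕ} (h : n ≠ m) (j : Fin 6) :
    Disjoint (kite L n j) (kite L m (j + 1)) := by
  refine Set.disjoint_left.2 fun z hz hz' => h ?_
  have h1 := (thr_strictAnti hL).lt_iff_gt.1 (hz.2.2.1.trans hz'.1)
  have h2 := (thr_strictAnti hL).lt_iff_gt.1 (hz'.2.1.trans hz.2.2.2)
  omega

lemma disjoint_kite_add_two (L : ℝ) (n m : ℕ) (j : Fin 6) :
    Disjoint (kite L n j) (kite L m (j + 2)) := by
  refine Set.disjoint_left.2 fun z hz hz' => ?_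
  have h : j + 2 + 5 = j + 1 := by rw [add_assoc]; rfl
  have h1 := (side_of_mem_kite hz).2
  have h2 := (side_of_mem_kite hz').1
  rw [h] at h2
  exact lt_asymm h1 h2

lemma disjoint_kite_add_three (L : ℝ) (n m : ℕ) (j : Fin 6) :
    Disjoint (kite L n j) (kite L m (j + 3)) := by
  refine Set.disjoint_left.2 fun z hz hz' => ?_
  have h : j + 3 + 1 = j + 1 + 3 := by rw [add_right_comm]
  have h1 := (side_of_mem_kite hz).2
  have h2 := (side_of_mem_kite hz').2
  rw [h, side_add_three] at h2
  linarith

lemma disjoint_kite {L : ℝ} (hL : 0 < L) {n m : ℕ} {i j : Fin 6} (hn : (n + i.val) % 2 = 1)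
    (hm : (m + j.val) % 2 = 1) (h : (n, i) ≠ (m, j)) : Disjoint (kite L n i) (kite L m j) := by
  have par : ∀ i : Fin 6, (i + 1).val % 2 = (i.val + 1) % 2 := by decide
  obtain ⟨d, rfl⟩ : ∃ d, j = i + d := ⟨j - i, by abel⟩
  fin_cases d
  · simp only [Fin.zero_eta, Fin.isValue, add_zero, ne_eq, Prod.mk.injEq, and_true] at h hm ⊢
    rcases lt_or_gt_of_ne h with h' | h'
    · exact disjoint_kite_self hL (by omega) i
    · exact (disjoint_kite_self hL (by omega) i).symm
  · refine disjoint_kite_succ hL (fun e => ?_) i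
    have := par i
    change (m + (i + 1).val) % 2 = 1 at hm
    omega
  · exact disjoint_kite_add_two L n m i
  · exact disjoint_kite_add_three L n m i
  · have h6 : i + 4 + 2 = i := by rw [add_assoc]; exact add_zero i
    have := disjoint_kite_add_two L m n (i + 4)
    rw [h6] at this
    exact this.symm
  · have := disjoint_kite_succ hL (n := m) (m := n) (j := i + 5) (fun e => by
      have := par (i + 5)
      rw [add_five_add_one] at this
      change (m + (i + 5).val) % 2 = 1 at hm
      omega)
    rw [add_five_add_one] at this
    exact this.symm

lemma ring_add_ray_odd (k : ℕ) (c : Cell) : (ring k c + (ray c).val) % 2 = 1 := by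
  cases c <;> simp [ring, ray] <;> omega

lemma ring_ray_injective : Function.Injective fun i : ℕ × Cell => (ring i.1 i.2, ray i.2) := by
  rintro ⟨k, c⟩ ⟨k', c'⟩ h
  cases c <;> cases c' <;> simp [ring, ray] at h ⊢ <;> omega

lemma pairwise_disjoint_cell {L : ℝ} (hL : 0 < L) :
    Pairwise fun i j : ℕ × Cell => Disjoint (cell L i.1 i.2) (cell L j.1 j.2) := fun _ _ hij =>
  (disjoint_kite hL (ring_add_ray_odd _ _) (ring_add_ray_odd _ _)
    (ring_ray_injective.ne hij)).mono (cell_subset_kite hL _ _) (cell_subset_kite hL _ _)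

/-! ### Covering -/

lemma tendsto_thr (L : ℝ) : Filter.Tendsto (thr L) Filter.atTop (𝓝 0) := by
  have := (tendsto_pow_atTop_nhds_zero_of_lt_one t_pos.le t_lt_one).const_mul
    (L * (2 + √3) / (2 * √3))
  rw [mul_zero] at this
  exact this

lemma exists_cell_eq (n : ℕ) (j : Fin 6) (h : (n + j.val) % 2 = 1) :
    ∃ k c, ring k c = n ∧ ray c = j := by
  fin_cases j <;> simp at h
  · exact ⟨n / 2, .A, by simp only [ring]; omega, rfl⟩
  · exact ⟨n / 2, .B, by simp only [ring]; omega, rfl⟩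
  · exact ⟨n / 2, .E, by simp only [ring]; omega, rfl⟩
  · exact ⟨n / 2, .D, by simp only [ring]; omega, rfl⟩
  · exact ⟨n / 2, .F, by simp only [ring]; omega, rfl⟩
  · exact ⟨n / 2, .C, by simp only [ring]; omega, rfl⟩

/-- The lines that carry the edges of the cells. -/
def gridLines (L : ℝ) : Set Plane :=
  ⋃ j : Fin 6, ⋃ n : ℕ, ({z | X j z = thr L n} ∪ {z | Y j z = thr L n})

/-- In a sector containing z, let n be the least ring of the right parity with `thr L (n + 1) < Y j
z`. If `X j z < thr L n`, the kite is (n, j). Otherwise it is (n - 1, j - 1): minimality of n bounds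
`Y j z` above, or the disk does so when n = 1. The disk rules this case out when n = 0. -/
lemma exists_mem_kite {L : ℝ} (hL : 0 < L) {z : Plane} (hz : z ∈ disk L) (h0 : z ≠ 0)
    (hg : z ∉ gridLines L) : ∃ n j, (n + j.val) % 2 = 1 ∧ z ∈ kite L n j := by
  obtain ⟨j, hj⟩ := exists_mem_sector z
  have hX : ∀ n, X j z ≠ thr L n := fun n e => hg <| by
    simp only [gridLines, Set.mem_iUnion]; exact ⟨j, n, Or.inl e⟩
  have hY : ∀ n, Y j z ≠ thr L n := fun n e => hg <| by
    simp only [gridLines, Set.mem_iUnion]; exact ⟨j, n, Or.inr e⟩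
  have hpos := nonneg_of_mem_sector hj
  have hb := frame_bound_of_mem_sector hj
  have hYpos : 0 < Y j z := by
    refine lt_of_le_of_ne hpos.2 fun e => h0 ?_
    rw [← e, mul_zero] at hb
    have h1 := norm_sq_eq_frame j z
    rw [← e, le_antisymm hb.2 hpos.1] at h1
    simpa using h1
  have hex : ∃ n, (n + j.val) % 2 = 1 ∧ thr L (n + 1) < Y j z := by
    obtain ⟨N, hN⟩ := ((tendsto_thr L).eventually (gt_mem_nhds hYpos)).exists_forall_of_atTop
    by_cases hp : (N + j.val) % 2 = 1
    · exact ⟨N, hp, hN _ (by omega)⟩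
    · exact ⟨N + 1, by omega, hN _ (by omega)⟩
  classical
  obtain ⟨hn1, hn2⟩ := Nat.find_spec hex
  have hmin := fun m => Nat.find_min hex (m := m)
  set n := Nat.find hex
  by_cases hx : X j z < thr L n
  · exact ⟨n, j, hn1, (mem_kite_left hj).2 ⟨hx, hn2⟩⟩
  have hx' : thr L n < X j z := lt_of_le_of_ne (not_lt.1 hx) (hX n).symm
  have par : ∀ i : Fin 6, (i + 5).val % 2 = (i.val + 1) % 2 := by decide
  have hj' : z ∈ sector (j + 5 + 1) := by rwa [add_five_add_one]
  have hd := lt_thr_zero_of_mem_disk hL hz j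
  have hp := par j
  rcases hn : n with _ | n'
  · rw [hn] at hn2 hx
    exact absurd (hd.1 hn2) hx
  · refine ⟨n', j + 5, by omega, (mem_kite_right hj').2 ?_⟩
    rw [add_five_add_one, ← hn]
    refine ⟨?_, hx'⟩
    rcases n' with _ | n''
    · rw [hn] at hx'
      exact hd.2 hx'
    · have h3 := hmin n'' (by omega)
      exact lt_of_le_of_ne (not_lt.1 fun e => h3 ⟨by omega, e⟩) (hY _)

lemma exists_mem_cell {L : ℝ} (hL : 0 < L) {z : Plane} (hz : z ∈ disk L) (h0 : z ≠ 0)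
    (hg : z ∉ gridLines L) : ∃ k c, z ∈ cell L k c := by
  obtain ⟨n, j, hp, hk⟩ := exists_mem_kite hL hz h0 hg
  obtain ⟨k, c, rfl, rfl⟩ := exists_cell_eq n j hp
  refine ⟨k, c, ?_⟩
  rw [cell_eq hL]
  exact ⟨hz, hk⟩

/-- The point with given coordinates in a rotated frame. -/
def ofFrame (j : Fin 6) (p q : ℝ) : Plane :=
  !₂[cosTab j * p - sinTab j * q, sinTab j * p + cosTab j * q]

lemma cosTab_sq_add_sinTab_sq (j : Fin 6) : cosTab j ^ 2 + sinTab j ^ 2 = 1 := by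
  have := sqrt_three_mul_self
  fin_cases j <;> simp [cosTab, sinTab] <;> grind

lemma X_ofFrame (j : Fin 6) (p q : ℝ) : X j (ofFrame j p q) = p := by
  simp [X, ofFrame]; linear_combination p * cosTab_sq_add_sinTab_sq j

lemma Y_ofFrame (j : Fin 6) (p q : ℝ) : Y j (ofFrame j p q) = q := by
  simp [Y, ofFrame]; linear_combination q * cosTab_sq_add_sinTab_sq j

lemma cell_nonempty {L : ℝ} (hL : 0 < L) (k : ℕ) (c : Cell) : (cell L k c).Nonempty := by
  have ht := t_pos
  have ht1 := t_lt_half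
  have ht2 := t_sq
  rw [cell_eq hL]
  set n := ring k c
  set j := ray c
  have hn := thr_pos hL n
  -- The witness is twice the inner tip. It lies on the axis, and is inside the disk even for ring
  -- 0.
  set z := ofFrame j (t * (2 * thr L (n + 1))) (2 * thr L (n + 1)) with hz
  have hX : X j z = t * (2 * thr L (n + 1)) := X_ofFrame _ _ _
  have hY : Y j z = 2 * thr L (n + 1) := Y_ofFrame _ _ _
  have hs : z ∈ sector j := by
    rw [mem_sector, hX, hY]
    refine ⟨le_rfl, ?_⟩
    rw [← mul_assoc]
    nlinarith [thr_pos hL (n + 1)]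
  refine ⟨z, ?_, (mem_kite_left hs).2 ⟨?_, ?_⟩⟩
  · rw [mem_disk hL j, radius_sq, hX, hY]
    have h1 : thr L (n + 1) ^ 2 ≤ thr L 1 ^ 2 :=
      pow_le_pow_left₀ (thr_pos hL _).le ((thr_strictAnti hL).antitone (by omega)) 2
    have h2 := mul_le_mul_of_nonneg_left h1 (by positivity : 0 ≤ 4 * (t ^ 2 + 1))
    have h3 : 4 * (t ^ 2 + 1) < 1 + (2 + √3) ^ 2 := by
      nlinarith [sqrt_three_mul_self, sqrt_three_pos]
    have h4 := mul_lt_mul_of_pos_right h3 (by have := thr_pos hL 1; positivity : 0 < thr L 1 ^ 2)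
    linarith
  · rw [hX, thr_succ]
    nlinarith [mul_pos ht hn]
  · rw [hY]
    linarith [thr_pos hL (n + 1)]

lemma le_ring (k : ℕ) (c : Cell) : 2 * k ≤ ring k c := by
  cases c <;> simp [ring]

lemma eventually_cell_subset {L : ℝ} (hL : 0 < L) {U : Set Plane} (hU : U ∈ 𝓝 (0 : Plane)) :
    ∀ᶠ k in Filter.atTop, ∀ c, cell L k c ⊆ U := by
  obtain ⟨r, hr, hrU⟩ := Metric.mem_nhds_iff.1 hU
  filter_upwards [(tendsto_thr L).eventually (gt_mem_nhds (by positivity : 0 < r / 4))]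
    with k hk c z hz
  refine hrU (mem_ball_zero_iff.2 ?_)
  have h1 := norm_lt_of_mem_kite hL (cell_subset_kite hL _ _ hz)
  have h2 := (thr_strictAnti hL).antitone
    (le_trans (by omega : k ≤ 2 * k) (le_ring k c))
  linarith

/-! ### Self-similarity -/

lemma rot_rot_neg (θ : ℝ) (z : Plane) : rot θ (rot (-θ) z) = z := by
  have h := Real.sin_sq_add_cos_sq θ
  ext i
  fin_cases i <;> simp [rot]
  · linear_combination z 0 * h
  · linear_combination z 1 * h

/-- Rotation as a linear isometry equivalence. -/
def rotEquiv (θ : ℝ) : Plane ≃ₗᵢ[ℝ] Plane where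
  toFun := rot θ
  invFun := rot (-θ)
  map_add' x y := by
    ext i; fin_cases i <;> simp [rot] <;> ring
  map_smul' c x := by
    ext i; fin_cases i <;> simp [rot] <;> ring
  left_inv z := by
    have := rot_rot_neg (-θ) z
    rwa [neg_neg] at this
  right_inv := rot_rot_neg θ
  norm_map' z := by
    have h := Real.sin_sq_add_cos_sq θ
    refine (pow_left_inj₀ (norm_nonneg _) (norm_nonneg _) two_ne_zero).1 ?_
    rw [norm_sq_eq, norm_sq_eq]
    simp [rot]
    linear_combination (z 0 ^ 2 + z 1 ^ 2) * h

@[simp] lemma rotEquiv_apply (θ : ℝ) (z : Plane) : rotEquiv θ z = rot θ z := rfl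

lemma rot_surjective (θ : ℝ) : Function.Surjective (rot θ) := (rotEquiv θ).surjective

lemma norm_rot (θ : ℝ) (z : Plane) : ‖rot θ z‖ = ‖z‖ := (rotEquiv θ).norm_map z

lemma cos_sin_neg_two_pi_div_three :
    Real.cos (-(2 * Real.pi / 3)) = -1 / 2 ∧ Real.sin (-(2 * Real.pi / 3)) = -(√3 / 2) := by
  have h : 2 * Real.pi / 3 = Real.pi - Real.pi / 3 := by ring
  rw [Real.cos_neg, Real.sin_neg, h, Real.cos_pi_sub, Real.sin_pi_sub, Real.cos_pi_div_three,
    Real.sin_pi_div_three]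
  exact ⟨by norm_num, rfl⟩

lemma frame_rot_neg_two_pi_div_three (j : Fin 6) (z : Plane) :
    X j (rot (-(2 * Real.pi / 3)) z) = X (j + 2) z ∧
      Y j (rot (-(2 * Real.pi / 3)) z) = Y (j + 2) z := by
  have h := sqrt_three_mul_self
  obtain ⟨hc, hs⟩ := cos_sin_neg_two_pi_div_three
  fin_cases j <;> simp [X, Y, rot, hc, hs, cosTab, sinTab] <;> constructor <;> grind

lemma frame_rot_pi_div_three (j : Fin 6) (z : Plane) :
    X (j + 1) (rot (Real.pi / 3) z) = X j z ∧ Y (j + 1) (rot (Real.pi / 3) z) = Y j z := by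
  have h := sqrt_three_mul_self
  have hc := Real.cos_pi_div_three
  have hs := Real.sin_pi_div_three
  fin_cases j <;> simp [X, Y, rot, hc, hs, cosTab, sinTab] <;> constructor <;> grind

lemma rot_neg_mem_kite {L : ℝ} {n : ℕ} {j : Fin 6} {z : Plane} :
    rot (-(2 * Real.pi / 3)) z ∈ kite L n j ↔ z ∈ kite L n (j + 2) := by
  have h : j + 2 + 1 = j + 1 + 2 := add_right_comm _ _ _
  simp only [kite, Set.mem_ofPred_eq, frame_rot_neg_two_pi_div_three, h]

lemma rot_pi_div_three_mem_kite {L : ℝ} {n : ℕ} {j : Fin 6} {z : Plane} :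
    rot (Real.pi / 3) z ∈ kite L n (j + 1) ↔ z ∈ kite L n j := by
  simp only [kite, Set.mem_ofPred_eq, frame_rot_pi_div_three]

lemma thr_add (L : ℝ) (n m : ℕ) : thr L (n + m) = t ^ m * thr L n := by
  rw [thr, thr, pow_add]; ring

lemma smul_mem_kite {L : ℝ} {n m : ℕ} {j : Fin 6} {z : Plane} :
    t ^ m • z ∈ kite L (n + m) j ↔ z ∈ kite L n j := by
  have h : n + m + 1 = n + 1 + m := by ring
  have hp : 0 < t ^ m := pow_pos t_pos m
  simp only [kite, Set.mem_ofPred_eq, X_smul, Y_smul, thr_add L n m, h, thr_add L (n + 1) m,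
    mul_lt_mul_iff_right₀ hp]

lemma rot_mem_disk {L θ : ℝ} {z : Plane} : rot θ z ∈ disk L ↔ z ∈ disk L := by
  rw [disk, mem_ball_zero_iff, mem_ball_zero_iff, norm_rot]

lemma image_eq_of_mem_iff {α β : Type*} {f : α → β} (hf : Function.Surjective f) {s : Set α}
    {s' : Set β} (h : ∀ z, f z ∈ s' ↔ z ∈ s) : s' = f '' s := by
  rw [← Set.image_preimage_eq s' hf]
  congr 1
  ext z
  exact h z

lemma cell_eq_image_rot {L : ℝ} (hL : 0 < L) {k : ℕ} {c c' : Cell} (hn : ring k c = ring k c')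
    (hj : ray c + 2 = ray c') : cell L k c = rot (-(2 * Real.pi / 3)) '' cell L k c' := by
  refine image_eq_of_mem_iff (rot_surjective _) fun z => ?_
  rw [cell_eq hL, cell_eq hL, Set.mem_inter_iff, Set.mem_inter_iff, rot_mem_disk,
    rot_neg_mem_kite, hn, hj]

lemma selfSimilar {L : ℝ} (hL : 0 < L) : SelfSimilar L := by
  intro k
  refine ⟨?_, ?_, cell_eq_image_rot hL rfl rfl, cell_eq_image_rot hL rfl rfl,
    cell_eq_image_rot hL rfl rfl, cell_eq_image_rot hL rfl rfl⟩
  · have hs : Function.Surjective fun z : Plane => t ^ (2 * k) • z := fun z =>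
      ⟨(t ^ (2 * k))⁻¹ • z, smul_inv_smul₀ (pow_ne_zero _ t_pos.ne') z⟩
    refine image_eq_of_mem_iff hs fun z => ?_
    rw [cell_eq_kite hL (by simp [ring]), cell_eq_kite hL (by simp [ring])]
    have h : ring k .A = ring 0 .A + 2 * k := by simp only [ring]; ring
    rw [h]
    exact smul_mem_kite
  · have hs : Function.Surjective fun z : Plane => t • rot (Real.pi / 3) z := fun z => by
      obtain ⟨w, hw⟩ := rot_surjective (Real.pi / 3) (t⁻¹ • z)
      exact ⟨w, by simp only [hw]; exact smul_inv_smul₀ t_pos.ne' z⟩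
    refine image_eq_of_mem_iff hs fun z => ?_
    rw [cell_eq_kite hL (by simp only [ring]; omega), cell_eq_kite hL (by simp [ring])]
    have h1 : ring (k + 1) .B = ring k .A + 1 := by simp only [ring]; ring
    have h2 : ray .B = ray .A + 1 := rfl
    have h := smul_mem_kite (L := L) (n := ring k .A) (m := 1) (j := ray .A + 1)
      (z := rot (Real.pi / 3) z)
    rw [pow_one] at h
    rw [h1, h2, h]
    exact rot_pi_div_three_mem_kite

/-! ### The cells are kites -/

/-- `X j` as a linear map. -/
def linX (j : Fin 6) : Plane →ₗ[ℝ] ℝ where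
  toFun := X j
  map_add' x y := by simp [X]; ring
  map_smul' c x := X_smul j c x

/-- `Y j` as a linear map. -/
def linY (j : Fin 6) : Plane →ₗ[ℝ] ℝ where
  toFun := Y j
  map_add' x y := by simp [Y]; ring
  map_smul' c x := Y_smul j c x

lemma X_add (j : Fin 6) (x y : Plane) : X j (x + y) = X j x + X j y := (linX j).map_add x y

lemma Y_add (j : Fin 6) (x y : Plane) : Y j (x + y) = Y j x + Y j y := (linY j).map_add x y

lemma isOpenMap_X (j : Fin 6) : IsOpenMap (X j) :=
  (linX j).isOpenMap_of_finiteDimensional fun p => ⟨ofFrame j p 0, X_ofFrame j p 0⟩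

lemma isOpenMap_Y (j : Fin 6) : IsOpenMap (Y j) :=
  (linY j).isOpenMap_of_finiteDimensional fun p => ⟨ofFrame j 0 p, Y_ofFrame j 0 p⟩

/-- The closed kite. -/
def closedKite (L : ℝ) (n : ℕ) (j : Fin 6) : Set Plane :=
  X j ⁻¹' Set.Iic (thr L n) ∩ (Y j ⁻¹' Set.Ici (thr L (n + 1)) ∩
    (X (j + 1) ⁻¹' Set.Ici (thr L (n + 1)) ∩ Y (j + 1) ⁻¹' Set.Iic (thr L n)))

/-- The coordinates are open continuous maps, so taking interiors commutes with preimages under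
them. -/
lemma interior_closedKite (L : ℝ) (n : ℕ) (j : Fin 6) :
    interior (closedKite L n j) = kite L n j := by
  have hX := fun (i : Fin 6) (s : Set ℝ) =>
    (isOpenMap_X i).preimage_interior_eq_interior_preimage (continuous_X i) s
  have hY := fun (i : Fin 6) (s : Set ℝ) =>
    (isOpenMap_Y i).preimage_interior_eq_interior_preimage (continuous_Y i) s
  simp only [closedKite, interior_inter, ← hX, ← hY, interior_Iic, interior_Ici]
  rfl

lemma convex_closedKite (L : ℝ) (n : ℕ) (j : Fin 6) : Convex ℝ (closedKite L n j) :=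
  ((convex_Iic _).linear_preimage (linX j)).inter <|
    ((convex_Ici _).linear_preimage (linY j)).inter <|
      ((convex_Ici _).linear_preimage (linX (j + 1))).inter <|
        (convex_Iic _).linear_preimage (linY (j + 1))

lemma ext_frame (j : Fin 6) {z w : Plane} (hX : X j z = X j w) (hY : Y j z = Y j w) : z = w := by
  have h : ‖z - w‖ ^ 2 = 0 := by
    have e1 := X_add j (z - w) w
    have e2 := Y_add j (z - w) w
    rw [sub_add_cancel] at e1 e2
    rw [norm_sq_eq_frame j]
    have e3 : X j (z - w) = 0 := by linarith
    have e4 : Y j (z - w) = 0 := by linarith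
    rw [e3, e4]; norm_num
  rw [← sub_eq_zero]
  simpa using h

lemma dist_sq_eq_frame (j : Fin 6) (z w : Plane) :
    dist z w ^ 2 = (X j z - X j w) ^ 2 + (Y j z - Y j w) ^ 2 := by
  have e1 := X_add j (z - w) w
  have e2 := Y_add j (z - w) w
  rw [sub_add_cancel] at e1 e2
  rw [dist_eq_norm, norm_sq_eq_frame j, e1, e2]
  ring

lemma mem_convexHull_of_frame (j : Fin 6) {p q r z : Plane} {s : Set Plane} (hp : p ∈ s)
    (hq : q ∈ s) (hr : r ∈ s) {a b c : ℝ} (ha : 0 ≤ a) (hb : 0 ≤ b) (hc : 0 ≤ c)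
    (habc : a + b + c = 1) (hX : X j z = a * X j p + b * X j q + c * X j r)
    (hY : Y j z = a * Y j p + b * Y j q + c * Y j r) : z ∈ convexHull ℝ s := by
  have hz : z = a • p + b • q + c • r := by
    apply ext_frame j <;> simp only [X_add, Y_add, X_smul, Y_smul, hX, hY]
  have h := (convex_convexHull ℝ s).sum_mem (t := Finset.univ) (w := ![a, b, c]) (z := ![p, q, r])
    (by intro i _; fin_cases i <;> simpa) (by simp [Fin.sum_univ_three, habc])
    (by intro i _; fin_cases i <;> exact subset_convexHull ℝ s (by assumption))
  rw [hz]
  simpa [Fin.sum_univ_three] using h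

set_option maxHeartbeats 2000000 in
-- The outer tip p and inner tip r lie on the ray, while q and q' lie on the far boundaries of the
-- two adjacent sectors and mirror each other in it. The axis splits the kite into two triangles,
-- where explicit barycentric coordinates place each point in the hull.
lemma isOpenKite_kite {L : ℝ} (hL : 0 < L) (n : ℕ) (j : Fin 6) : IsOpenKite (kite L n j) := by
  have ht := t_pos
  have ht1 := t_lt_half
  have ht2 := t_sq
  have ha := thr_pos hL n
  set a := thr L n with hadef
  have ha1 : thr L (n + 1) = t * a := thr_succ L n
  have hD0 : 0 < 1 - t * t := by rw [ht2]; linarith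
  have hD : 0 < (1 - t * t) * a := mul_pos hD0 ha
  have hD2 : 1 - t ^ 2 ≠ 0 := by rw [sq]; exact hD0.ne'
  have e0 (c d : ℝ) (h : c ≤ d) : c * a ≤ d * a := mul_le_mul_of_nonneg_right h ha.le
  have e1 : t * (t * a) ≤ a := by rw [← mul_assoc]; linarith
  have e2 : t * a ≤ a := by linarith [e0 t 1 (by linarith)]
  have e3 : t * a ≤ (4 - t) * a := e0 _ _ (by linarith)
  have e4 : (t - 1) * a ≤ a := by linarith [e0 (t - 1) 1 (by linarith)]
  have e5 : t * a ≤ (1 - t) * a := e0 _ _ (by linarith)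
  have hs : √3 = 2 - t := sqrt_three_eq
  set p := ofFrame j a ((4 - t) * a)
  set r := ofFrame j (t * (t * a)) (t * a)
  set q := ofFrame j a (t * a)
  set q' := ofFrame (j + 1) (t * a) a
  have Xp : X j p = a := X_ofFrame ..
  have Yp : Y j p = (4 - t) * a := Y_ofFrame ..
  have Xq : X j q = a := X_ofFrame ..
  have Yq : Y j q = t * a := Y_ofFrame ..
  have Xr : X j r = t * (t * a) := X_ofFrame ..
  have Yr : Y j r = t * a := Y_ofFrame ..
  have Xq1 : X (j + 1) q' = t * a := X_ofFrame ..
  have Yq1 : Y (j + 1) q' = a := Y_ofFrame ..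
  have Xp1 : X (j + 1) p = (4 - t) * a := by rw [X_succ, Xp, Yp, hs]; linear_combination (a / 2) * ht2
  have Yp1 : Y (j + 1) p = a := by rw [Y_succ, Xp, Yp, hs]; ring
  have Xr1 : X (j + 1) r = t * a := by rw [X_succ, Xr, Yr, hs]; ring
  have Yr1 : Y (j + 1) r = t * (t * a) := by rw [Y_succ, Xr, Yr, hs]; linear_combination (t * a / 2) * ht2
  have Xq2 : X (j + 1) q = (1 - t) * a := by rw [X_succ, Xq, Yq, hs]; linear_combination (-a / 2) * ht2
  have Yq2 : Y (j + 1) q = (t - 1) * a := by rw [Y_succ, Xq, Yq, hs]; ring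
  have Xq3 : X j q' = (t - 1) * a := by rw [X_pred, Xq1, Yq1, hs]; ring
  have Yq3 : Y j q' = (1 - t) * a := by rw [Y_pred, Xq1, Yq1, hs]; linear_combination (-a / 2) * ht2
  clear_value p q r q'
  have hD1 : 0 < 4 - 2 * t := by linarith
  have hta := mul_pos ht ha
  have htta := mul_pos ht hta
  refine ⟨p, q, r, q', fun e => ?_, fun e => ?_, ?_, ?_, ?_, ?_⟩
  · have := congrArg (Y j) e
    rw [Yp, Yr] at this
    linarith [mul_right_cancel₀ ha.ne' this]
  · have := congrArg (X j) e
    rw [Xq, Xq3] at this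
    linarith [mul_right_cancel₀ ha.ne' ((one_mul a).trans this)]
  · refine (pow_left_inj₀ dist_nonneg dist_nonneg two_ne_zero).1 ?_
    rw [dist_sq_eq_frame j, dist_sq_eq_frame (j + 1), Xp, Yp, Xq, Yq, Xp1, Yp1, Xq1, Yq1]
    ring
  · refine (pow_left_inj₀ dist_nonneg dist_nonneg two_ne_zero).1 ?_
    rw [dist_sq_eq_frame j, dist_sq_eq_frame (j + 1), Xr, Yr, Xq, Yq, Xr1, Yr1, Xq1, Yq1]
    ring
  -- The midpoint of q and q' has `X j` equal to ta/2. These weights solve the equation on the axis,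
  -- and the first is positive because t < 1/2.
  · refine ⟨(1 / 2 - t) / (4 - 2 * t), (7 / 2 - t) / (4 - 2 * t), div_pos (by linarith) hD1,
      div_pos (by linarith) hD1, ?_, ?_⟩
    · rw [← add_div, div_eq_one_iff_eq hD1.ne']; ring
    · rw [midpoint_eq_smul_add]
      apply ext_frame j <;>
        simp only [X_add, Y_add, X_smul, Y_smul, Xp, Xr, Yp, Yr, Xq, Yq, Xq3, Yq3, invOf_eq_inv] <;>
        field_simp <;> grind
  · have hsub : ({p, q, r, q'} : Set Plane) ⊆ closedKite L n j := by
      rintro z (rfl | rfl | rfl | rfl) <;>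
        refine ⟨?_, ?_, ?_, ?_⟩ <;> simp only [Set.mem_preimage, Set.mem_Iic, Set.mem_Ici,
          Xp, Yp, Xq, Yq, Xr, Yr, Xp1, Yp1, Xq1, Yq1, Xr1, Yr1, Xq2, Yq2, Xq3, Yq3, ha1, le_refl, ← hadef] <;>
        assumption
    refine Set.Subset.antisymm (interior_maximal ?_ (isOpen_kite L n j)) ?_
    · intro z hz
      have hm1 : p ∈ ({p, q, r, q'} : Set Plane) := by simp
      have hm2 : q ∈ ({p, q, r, q'} : Set Plane) := by simp
      have hm3 : r ∈ ({p, q, r, q'} : Set Plane) := by simp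
      have hm4 : q' ∈ ({p, q, r, q'} : Set Plane) := by simp
      have hsec := mem_sector_of_mem_kite hz
      obtain ⟨h1, h2, h3, h4⟩ := hz
      rw [ha1] at h2 h3
      rcases hsec with hs' | hs'
      · have h5 := (mem_sector.1 hs').1
        -- Each weight is a normalised distance to the opposite edge: `Y j = t * a` for p, the axis
        -- for q, and `X j = a` for r.
        refine mem_convexHull_of_frame j hm1 hm2 hm3
          (a := t * (Y j z - t * a) / ((1 - t * t) * a))
          (b := (X j z - t * Y j z) / ((1 - t * t) * a)) (c := (a - X j z) / ((1 - t * t) * a))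
          (div_nonneg (mul_nonneg ht.le (by linarith)) hD.le) (div_nonneg (by linarith) hD.le)
          (div_nonneg (by linarith) hD.le) ?_ ?_ ?_
        · rw [← add_div, ← add_div, div_eq_one_iff_eq hD.ne']; ring
        · rw [Xp, Xq, Xr]; field_simp; ring
        · rw [Yp, Yq, Yr, show (4 - t) * a = a / t by field_simp; linarith]; field_simp; ring
      · have h5 := (mem_sector.1 hs').2
        refine mem_convexHull_of_frame (j + 1) hm1 hm4 hm3
          (a := t * (X (j + 1) z - t * a) / ((1 - t * t) * a))
          (b := (Y (j + 1) z - t * X (j + 1) z) / ((1 - t * t) * a))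
          (c := (a - Y (j + 1) z) / ((1 - t * t) * a))
          (div_nonneg (mul_nonneg ht.le (by linarith)) hD.le) (div_nonneg (by linarith) hD.le)
          (div_nonneg (by linarith) hD.le) ?_ ?_ ?_
        · rw [← add_div, ← add_div, div_eq_one_iff_eq hD.ne']; ring
        · rw [Xp1, Xq1, Xr1, show (4 - t) * a = a / t by field_simp; linarith]; field_simp; ring
        · rw [Yp1, Yq1, Yr1]; field_simp; ring
    · rw [← interior_closedKite]
      exact interior_mono (convexHull_min hsub (convex_closedKite L n j))

lemma isOpenKite_cell {L : ℝ} (hL : 0 < L) (k : ℕ) (c : Cell)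
    (h : k = 0 → c = .A ∨ c = .E ∨ c = .F) : IsOpenKite (cell L k c) := by
  have h1 : 1 ≤ ring k c := by
    rcases k with _ | k
    · rcases h rfl with rfl | rfl | rfl <;> simp [ring]
    · exact le_trans (by omega) (le_ring (k + 1) c)
  rw [cell_eq_kite hL h1]
  exact isOpenKite_kite hL _ _

/-! ### The profile functions -/

/-- The sum of the positive parts of `thr L (2 * i + p + 1) - s`. -/
def profile (L : ℝ) (p : ℕ) (s : ℝ) : ℝ :=
  ∑' i : ℕ, max (thr L (2 * i + p + 1) - max s 0) 0

lemma thr_two_mul_add (L : ℝ) (i p : ℕ) :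
    thr L (2 * i + p + 1) = thr L (p + 1) * (t ^ 2) ^ i := by
  rw [thr, thr, ← pow_mul]; ring

lemma summable_thr (L : ℝ) (p : ℕ) : Summable fun i => thr L (2 * i + p + 1) := by
  simp only [thr_two_mul_add]
  refine (summable_geometric_of_lt_one (by positivity) ?_).mul_left _
  exact pow_lt_one₀ t_pos.le t_lt_one two_ne_zero

lemma profile_term_le {L : ℝ} (hL : 0 < L) (p i : ℕ) (s : ℝ) :
    ‖max (thr L (2 * i + p + 1) - max s 0) 0‖ ≤ thr L (2 * i + p + 1) := by
  have := thr_pos hL (2 * i + p + 1)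
  have := le_max_right s 0
  rw [Real.norm_of_nonneg (le_max_right _ _)]
  exact max_le (by linarith) (by linarith)

lemma summable_profile {L : ℝ} (hL : 0 < L) (p : ℕ) (s : ℝ) :
    Summable fun i : ℕ => max (thr L (2 * i + p + 1) - max s 0) 0 :=
  (summable_thr L p).of_norm_bounded fun i => profile_term_le hL p i s

lemma continuous_profile {L : ℝ} (hL : 0 < L) (p : ℕ) : Continuous (profile L p) :=
  continuous_tsum (fun i => by fun_prop) (summable_thr L p) fun i s => profile_term_le hL p i s

lemma profile_one_mul (L s : ℝ) : profile L 1 (t * s) = t * profile L 0 s := by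
  rw [profile, profile, ← tsum_mul_left]
  congr 1
  ext i
  have h1 : max (t * s) 0 = t * max s 0 := by rw [mul_max_of_nonneg _ _ t_pos.le, mul_zero]
  have h2 : thr L (2 * i + 1 + 1) = t * thr L (2 * i + 0 + 1) := thr_succ _ _
  rw [h1, h2, ← mul_sub, mul_max_of_nonneg _ _ t_pos.le, mul_zero]

/-- Scaling by t shifts every threshold by one index. The parity-0 series has one extra leading
term, and `h` says that its positive part is active. -/
lemma profile_zero_mul {L : ℝ} (hL : 0 < L) {s : ℝ} (hs : 0 ≤ s) (h : t * s ≤ thr L 1) :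
    profile L 0 (t * s) = thr L 1 - t * s + t * profile L 1 s := by
  rw [profile, (summable_profile hL 0 (t * s)).tsum_eq_zero_add, profile, ← tsum_mul_left]
  have h0 : max (t * s) 0 = t * s := max_eq_left (mul_nonneg t_pos.le hs)
  congr 1
  · rw [h0, max_eq_left]
    linarith
  · congr 1
    ext i
    have h2 : thr L (2 * (i + 1) + 0 + 1) = t * thr L (2 * i + 1 + 1) := thr_succ _ _
    rw [h0, h2, max_eq_left hs, ← mul_sub, mul_max_of_nonneg _ _ t_pos.le, mul_zero]

/-- Here m counts the thresholds above s. The second hypothesis is conditional because for m = 0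
there is no threshold to stay below. -/
lemma profile_eq {L : ℝ} (hL : 0 < L) {p m : ℕ} {s : ℝ} (h : thr L (2 * m + p + 1) ≤ s)
    (h' : ∀ n, m = n + 1 → s ≤ thr L (2 * n + p + 1)) :
    profile L p s = thr L (p + 1) * ∑ i ∈ Finset.range m, t ^ (2 * i) - m * s := by
  have hs : max s 0 = s := max_eq_left ((thr_pos hL _).le.trans h)
  have hz : ∀ i ∉ Finset.range m, max (thr L (2 * i + p + 1) - max s 0) 0 = 0 := by
    intro i hi
    have := (thr_strictAnti hL).antitone
      (by rw [Finset.mem_range] at hi; omega : 2 * m + p + 1 ≤ 2 * i + p + 1)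
    exact max_eq_right (by linarith)
  rw [profile, tsum_eq_sum hz, Finset.mul_sum]
  have hpos : ∀ i ∈ Finset.range m, max (thr L (2 * i + p + 1) - max s 0) 0 =
      thr L (p + 1) * t ^ (2 * i) - s := by
    intro i hi
    rw [Finset.mem_range] at hi
    obtain ⟨n, rfl⟩ : ∃ n, m = n + 1 := ⟨m - 1, by omega⟩
    have := (thr_strictAnti hL).antitone (by omega : 2 * i + p + 1 ≤ 2 * n + p + 1)
    have := h' n rfl
    rw [hs, max_eq_left (by linarith), thr_two_mul_add, pow_mul]
  rw [Finset.sum_congr rfl hpos, Finset.sum_sub_distrib]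
  simp

lemma profile_max_eq_sum {L : ℝ} (hL : 0 < L) {p m : ℕ} {r : ℝ} (h : thr L (2 * m + p + 1) ≤ r)
    (s : ℝ) : profile L p (max s r) =
      ∑ i ∈ Finset.range m, max (thr L (2 * i + p + 1) - max s r) 0 := by
  have hs : max (max s r) 0 = max s r :=
    max_eq_left (((thr_pos hL _).le.trans h).trans (le_max_right _ _))
  rw [profile, tsum_eq_sum (s := Finset.range m), hs]
  intro i hi
  have := (thr_strictAnti hL).antitone
    (by rw [Finset.mem_range] at hi; omega : 2 * m + p + 1 ≤ 2 * i + p + 1)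
  have := le_max_right s r
  rw [hs]
  exact max_eq_right (by linarith)

/-! ### The displacement -/

/-- The outermost cell that meets a sector. -/
def outer : Fin 6 → Cell := ![.C, .B, .B, .D, .D, .C]

/-- The unscaled displacement in a sector. -/
def sectorMap (L : ℝ) (j : Fin 6) (z : Plane) : Plane :=
  v L 0 (outer j) z + (2 * √3) • ofFrame j (-profile L ((j.val + 1) % 2) (Y j z))
    (profile L (j.val % 2) (X j z))

lemma ofFrame_X_Y (j : Fin 6) (z : Plane) : ofFrame j (X j z) (Y j z) = z :=
  ext_frame j (X_ofFrame _ _ _) (Y_ofFrame _ _ _)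

lemma coord_eq (j : Fin 6) (z : Plane) :
    z 0 = cosTab j * X j z - sinTab j * Y j z ∧ z 1 = sinTab j * X j z + cosTab j * Y j z := by
  have h := ofFrame_X_Y j z
  constructor
  · conv_lhs => rw [← h]
    rfl
  · conv_lhs => rw [← h]
    rfl

lemma sectorMap_eq_succ_even {L : ℝ} {y q : ℝ} {z : Plane} (j : Fin 6) (hj : j.val % 2 = 0)
    (h0 : z 0 = cosTab j * (t * y) - sinTab j * y) (h1 : z 1 = sinTab j * (t * y) + cosTab j * y) :
    v L 0 (outer j) z + (2 * √3) • ofFrame j (-q) (thr L 1 - t * y + t * q) =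
    v L 0 (outer (j + 1)) z + (2 * √3) • ofFrame (j + 1) (-(thr L 1 - t * y + t * q)) q := by
  have hs := sqrt_three_mul_self
  have ht := thr_odd L 0
  simp only [mul_zero, zero_add, pow_zero, mul_one] at ht
  rw [ht]
  rw [t_eq] at *
  ext i
  fin_cases j <;> simp at hj <;> fin_cases i <;>
    simp [outer, v, ofFrame, cosTab, sinTab, h0, h1] <;> clear h0 h1 ht <;> grind

lemma sectorMap_eq_succ_odd {L : ℝ} {y q : ℝ} {z : Plane} (j : Fin 6) (hj : j.val % 2 = 1)
    (h0 : z 0 = cosTab j * (t * y) - sinTab j * y) (h1 : z 1 = sinTab j * (t * y) + cosTab j * y) :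
    v L 0 (outer j) z + (2 * √3) • ofFrame j (-q) (t * q) =
    v L 0 (outer (j + 1)) z + (2 * √3) • ofFrame (j + 1) (-(t * q)) q := by
  have hs := sqrt_three_mul_self
  rw [t_eq] at *
  ext i
  fin_cases j <;> simp at hj <;> fin_cases i <;>
    simp [outer, v, ofFrame, cosTab, sinTab, h0, h1] <;> clear h0 h1 <;> grind

/-- On the common ray the two frames exchange coordinates, `X (j + 1) z = Y j z` and `Y (j + 1) z =
X j z = t * Y j z`. The parities are exchanged too, so both sides involve the same two profile
values. The functional equations express these through one unknown q, and the rest is algebra. -/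
lemma sectorMap_succ {L : ℝ} (hL : 0 < L) {z : Plane} {j : Fin 6}
    (hz : z ∈ closure (disk L)) (h1 : z ∈ sector j) (h2 : z ∈ sector (j + 1)) :
    sectorMap L j z = sectorMap L (j + 1) z := by
  have hside : side j z = 0 := le_antisymm (mem_sector_succ.1 h2).2 h1.1
  have hX : X j z = t * Y j z := by rw [side] at hside; linarith
  have hX1 : X (j + 1) z = Y j z := by
    rw [X_succ, hX, sqrt_three_eq]; ring
  have hY1 : Y (j + 1) z = t * Y j z := by
    rw [Y_succ, hX, sqrt_three_eq]; linear_combination (Y j z / 2) * t_sq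
  have hpos := nonneg_of_mem_sector h1
  obtain ⟨e0, e1⟩ := coord_eq j z
  rw [hX] at e0 e1
  -- On the ray, the closed disk ends exactly at the tip where `X j` equals `thr L 1`.
  have hbound : t * Y j z ≤ thr L 1 := by
    rw [disk, closure_ball _ (radius_pos hL).ne', mem_closedBall_zero_iff,
      ← pow_le_pow_iff_left₀ (norm_nonneg _) (radius_pos hL).le two_ne_zero, radius_sq,
      norm_sq_eq_frame j] at hz
    have h4 : (2 + √3) * t = 1 := by rw [t_eq]; linear_combination -sqrt_three_mul_self
    have h6 : (t * Y j z) ^ 2 * (1 + (2 + √3) ^ 2) ≤ thr L 1 ^ 2 * (1 + (2 + √3) ^ 2) := by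
      refine le_trans (le_of_eq ?_) hz
      rw [hX]
      linear_combination Y j z ^ 2 * ((2 + √3) * t + 1) * h4
    exact le_of_sq_le_sq (le_of_mul_le_mul_right h6 (by positivity)) (thr_pos hL 1).le
  have par : ∀ i : Fin 6, (i + 1).val % 2 = (i.val + 1) % 2 := by decide
  have par' : ((j + 1).val + 1) % 2 = j.val % 2 := by have := par j; omega
  rw [sectorMap, sectorMap, par', par j, hX1, hY1, hX]
  rcases Nat.mod_two_eq_zero_or_one j.val with hj | hj
  · have hj' : (j.val + 1) % 2 = 1 := by omega
    rw [hj, hj', profile_zero_mul hL hpos.2 hbound]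
    exact sectorMap_eq_succ_even j hj e0 e1
  · have hj' : (j.val + 1) % 2 = 0 := by omega
    rw [hj, hj', profile_one_mul]
    exact sectorMap_eq_succ_odd j hj e0 e1

lemma eq_zero_of_side_eq_zero {j : Fin 6} {z : Plane} (h : side j z = 0)
    (h' : side (j + 1) z = 0) : z = 0 := by
  rw [side_eq_succ] at h
  rw [side] at h'
  have h3 : (t * t - 1) * Y (j + 1) z = 0 := by linear_combination h - t * h'
  have h4 : Y (j + 1) z = 0 := by
    rcases mul_eq_zero.1 h3 with h5 | h5
    · have := t_sq
      have := t_lt_half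
      linarith
    · exact h5
  apply ext_frame (j + 1)
  · rw [h4, mul_zero, sub_zero] at h'
    rw [h']; simp [X]
  · rw [h4]; simp [Y]

lemma sectorMap_zero {L : ℝ} (hL : 0 < L) (i j : Fin 6) : sectorMap L i 0 = sectorMap L j 0 := by
  have h0 : (0 : Plane) ∈ closure (disk L) :=
    subset_closure (Metric.mem_ball_self (radius_pos hL))
  have hs : ∀ j, (0 : Plane) ∈ sector j := fun j => by
    rw [mem_sector]; simp [X, Y]
  have h : ∀ j, sectorMap L j 0 = sectorMap L (j + 1) 0 := fun j =>
    sectorMap_succ hL h0 (hs _) (hs _)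
  have key : ∀ j, sectorMap L j 0 = sectorMap L 0 0 := by
    have h1 := h 0
    have h2 := h 1
    have h3 := h 2
    have h4 := h 3
    have h5 := h 4
    simp only [Fin.isValue, Fin.reduceAdd, zero_add] at h1 h2 h3 h4 h5
    intro j
    fin_cases j
    · rfl
    · exact h1.symm
    · exact (h1.trans h2).symm
    · exact (h1.trans (h2.trans h3)).symm
    · exact (h1.trans (h2.trans (h3.trans h4))).symm
    · exact (h1.trans (h2.trans (h3.trans (h4.trans h5)))).symm
  rw [key i, key j]

/-- Adjacent sectors agree on their ray and non-adjacent ones meet only at the origin, so on the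
closed disk the choice of sector in `disp` is immaterial. -/
lemma sectorMap_eq_sectorMap {L : ℝ} (hL : 0 < L) {z : Plane} {i j : Fin 6}
    (hz : z ∈ closure (disk L)) (hi : z ∈ sector i) (hj : z ∈ sector j) :
    sectorMap L i z = sectorMap L j z := by
  have two : ∀ i : Fin 6, z ∈ sector i → z ∈ sector (i + 2) → z = 0 := by
    intro i hi hj
    have e : i + 2 = i + 1 + 1 := by rw [add_assoc]; rfl
    have h1 := hi.1
    rw [e, mem_sector_succ] at hj
    have h2 := side_add_two i z
    rw [e] at h2
    exact eq_zero_of_side_eq_zero (j := i) (by linarith) (by linarith)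
  obtain ⟨d, rfl⟩ : ∃ d, j = i + d := ⟨j - i, by abel⟩
  have six : ∀ a b : Fin 6, a + b = 0 → i + a + b = i := fun a b h => by
    rw [add_assoc, h, add_zero]
  fin_cases d
  · simp
  · exact sectorMap_succ hL hz hi hj
  · rw [two i hi hj]; exact sectorMap_zero hL _ _
  · have h0 : z = 0 := by
      have e : i + 3 = i + 2 + 1 := by rw [add_assoc]; rfl
      have e2 : i + 2 = i + 1 + 1 := by rw [add_assoc]; rfl
      change z ∈ sector (i + 3) at hj
      have h1 := hi.1
      have h2 := hi.2
      have h3 := hj.1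
      have h4 := hj
      rw [e, mem_sector_succ] at h4
      have h5 := side_add_three i z
      have h6 := side_add_three (i + 2) z
      have h7 : i + 2 + 3 = i + 5 := by rw [add_assoc]; rfl
      rw [h7] at h6
      have h8 := side_add_two i z
      exact eq_zero_of_side_eq_zero (j := i) (by linarith) (by linarith)
    rw [h0]; exact sectorMap_zero hL _ _
  · have h := two (i + 4) hj (by rw [six 4 2 rfl]; exact hi)
    rw [h]; exact sectorMap_zero hL _ _
  · have h := sectorMap_succ hL (j := i + 5) hz hj (by rw [six 5 1 rfl]; exact hi)
    rw [six 5 1 rfl] at h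
    exact h.symm

/-- The displacement of the microstructure. -/
def disp (L ε : ℝ) (z : Plane) : Plane :=
  ε • sectorMap L (Classical.choose (exists_mem_sector z)) z

lemma disp_eq {L : ℝ} (hL : 0 < L) (ε : ℝ) {z : Plane} {j : Fin 6} (hz : z ∈ closure (disk L))
    (hj : z ∈ sector j) : disp L ε z = ε • sectorMap L j z := by
  rw [disp, sectorMap_eq_sectorMap hL hz (Classical.choose_spec (exists_mem_sector z)) hj]

lemma continuous_v (L : ℝ) (k : ℕ) (c : Cell) : Continuous (v L k c) := by
  have h0 : Continuous fun z : Plane => z 0 := by fun_prop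
  have h1 : Continuous fun z : Plane => z 1 := by fun_prop
  cases c <;> refine (PiLp.continuous_toLp 2 _).comp (continuous_pi fun i => ?_) <;>
    fin_cases i <;> simp <;> fun_prop

lemma continuous_sectorMap {L : ℝ} (hL : 0 < L) (j : Fin 6) : Continuous (sectorMap L j) := by
  have h1 := fun p => continuous_profile hL p
  have h2 := continuous_X j
  have h3 := continuous_Y j
  have h4 := continuous_v L 0 (outer j)
  have h5 := (h1 ((j.val + 1) % 2)).comp h3
  have h6 := (h1 (j.val % 2)).comp h2
  have h7 : Continuous fun z => ofFrame j (-profile L ((j.val + 1) % 2) (Y j z))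
      (profile L (j.val % 2) (X j z)) := by
    refine (PiLp.continuous_toLp 2 _).comp (continuous_pi fun i => ?_)
    fin_cases i
    · exact (continuous_const.mul h5.neg).sub (continuous_const.mul h6)
    · exact (continuous_const.mul h5.neg).add (continuous_const.mul h6)
  have h8 : Continuous fun z => (2 * √3) • ofFrame j (-profile L ((j.val + 1) % 2) (Y j z))
      (profile L (j.val % 2) (X j z)) := h7.const_smul (2 * √3)
  exact h4.add h8

/-- Six continuous maps are pasted on a finite closed cover. The origin needs no separate argument
because the profiles are continuous there. -/
lemma continuousOn_disp {L : ℝ} (hL : 0 < L) (ε : ℝ) :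
    ContinuousOn (disp L ε) (closure (disk L)) := by
  have h : closure (disk L) = ⋃ j, (closure (disk L) ∩ sector j) := by
    rw [← Set.inter_iUnion, Set.inter_eq_left.2]
    intro z _
    exact Set.mem_iUnion.2 (exists_mem_sector z)
  rw [h]
  refine (locallyFinite_of_finite _).continuousOn_iUnion
    (fun j => isClosed_closure.inter (isClosed_sector j)) fun j => ?_
  refine ((continuous_sectorMap hL j).const_smul ε).continuousOn.congr fun z hz => ?_
  exact disp_eq hL ε hz.1 hz.2

/-! ### The displacement on the cells -/

/-- Eliminates the power in favour of the geometric sum in `shift`, so that the identities on the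
cells become polynomial in √3, k, the sum and the coordinates. -/
lemma pow_two_mul_eq (k : ℕ) :
    t ^ (2 * k) = 1 - (1 - t ^ 2) * ∑ i ∈ Finset.range k, t ^ (2 * i) := by
  have h := mul_neg_geom_sum (t ^ 2) k
  simp only [← pow_mul] at h
  rw [h]; ring

section
variable {L : ℝ} {n m p : ℕ} {j : Fin 6} {z : Plane}

/-- On this half of the kite `X j z` lies between `thr L (n + 2)` and `thr L n`, consecutive
thresholds of the relevant parity, so the profile is affine with slope -m. -/
lemma profile_X_of_mem_kite_left (hL : 0 < L) (hz : z ∈ kite L n j) (hs : z ∈ sector j)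
    (h : n + 1 = 2 * m + p) : profile L p (X j z) =
      thr L (p + 1) * ∑ i ∈ Finset.range m, t ^ (2 * i) - m * X j z := by
  obtain ⟨hX, hY⟩ := (mem_kite_left hs).1 hz
  refine profile_eq hL ?_ fun k e => ?_
  · rw [← h, thr_succ]
    exact (mul_le_mul_of_nonneg_left hY.le t_pos.le).trans (mem_sector.1 hs).1
  · rw [show 2 * k + p + 1 = n by omega]
    exact hX.le

lemma profile_Y_of_mem_kite_left (hL : 0 < L) (hz : z ∈ kite L n j) (hs : z ∈ sector j)
    (h : n = 2 * m + p) : profile L p (Y j z) =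
      thr L (p + 1) * ∑ i ∈ Finset.range m, t ^ (2 * i) - m * Y j z := by
  obtain ⟨hX, hY⟩ := (mem_kite_left hs).1 hz
  refine profile_eq hL (by rw [← h]; exact hY.le) fun k e => ?_
  rw [show n = 2 * k + p + 1 + 1 by omega, thr_succ] at hX
  exact le_of_mul_le_mul_left ((mem_sector.1 hs).1.trans hX.le) t_pos

lemma profile_Y_of_mem_kite_right (hL : 0 < L) (hz : z ∈ kite L n j) (hs : z ∈ sector (j + 1))
    (h : n + 1 = 2 * m + p) : profile L p (Y (j + 1) z) =
      thr L (p + 1) * ∑ i ∈ Finset.range m, t ^ (2 * i) - m * Y (j + 1) z := by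
  obtain ⟨hX, hY⟩ := (mem_kite_right hs).1 hz
  refine profile_eq hL ?_ fun k e => ?_
  · rw [← h, thr_succ]
    exact (mul_le_mul_of_nonneg_left hY.le t_pos.le).trans (mem_sector.1 hs).2
  · rw [show 2 * k + p + 1 = n by omega]
    exact hX.le

lemma profile_X_of_mem_kite_right (hL : 0 < L) (hz : z ∈ kite L n j) (hs : z ∈ sector (j + 1))
    (h : n = 2 * m + p) : profile L p (X (j + 1) z) =
      thr L (p + 1) * ∑ i ∈ Finset.range m, t ^ (2 * i) - m * X (j + 1) z := by
  obtain ⟨hX, hY⟩ := (mem_kite_right hs).1 hz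
  refine profile_eq hL (by rw [← h]; exact hY.le) fun k e => ?_
  rw [show n = 2 * k + p + 1 + 1 by omega, thr_succ] at hX
  exact le_of_mul_le_mul_left ((mem_sector.1 hs).2.trans hX.le) t_pos

end

/-- The ray is even and the ring odd: k + 1 thresholds lie above X and k above Y. For odd rays both
counts are k. This imbalance of one or zero is what switches the strain. -/
lemma sectorMap_eq_left_even {L : ℝ} (hL : 0 < L) {k : ℕ} {c : Cell} {z : Plane}
    (hc : c = .A ∨ c = .E ∨ c = .F) (hz : z ∈ kite L (ring k c) (ray c)) (hs : z ∈ sector (ray c)) :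
    sectorMap L (ray c) z = v L k c z + shift L k := by
  have hX := profile_X_of_mem_kite_left (p := 0) (m := (k + 1)) hL hz hs
    (by rcases hc with rfl | rfl | rfl <;> rfl)
  have hY := profile_Y_of_mem_kite_left (p := 1) (m := k) hL hz hs
    (by rcases hc with rfl | rfl | rfl <;> rfl)
  have h : sectorMap L (ray c) z = v L 0 (outer (ray c)) z + (2 * √3) •
      ofFrame (ray c) (-profile L 1 (Y (ray c) z)) (profile L 0 (X (ray c) z)) := by
    rcases hc with rfl | rfl | rfl <;> rfl
  have h3 := sqrt_three_mul_self
  have ht := pow_two_mul_eq k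
  have e1 := thr_odd L 0
  have e2 := thr_even L 0
  simp only [mul_zero, zero_add, pow_zero, mul_one] at e1 e2
  rw [h, hX, hY]
  clear h hX hY hz hs
  simp only [zero_add, Nat.reduceAdd, e1, e2, Finset.sum_range_succ, shift, X, Y]
  clear e1 e2
  set G := ∑ i ∈ Finset.range k, t ^ (2 * i)
  clear_value G
  rw [t_eq] at ht
  ext i
  rcases hc with rfl | rfl | rfl <;> fin_cases i <;>
    simp [outer, ray, v, ofFrame, cosTab, sinTab, t_eq, ht] <;> clear ht <;> grind

lemma sectorMap_eq_left_odd {L : ℝ} (hL : 0 < L) {k : ℕ} {c : Cell} {z : Plane}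
    (hc : c = .B ∨ c = .C ∨ c = .D) (hz : z ∈ kite L (ring k c) (ray c)) (hs : z ∈ sector (ray c)) :
    sectorMap L (ray c) z = v L k c z + shift L k := by
  have hX := profile_X_of_mem_kite_left (p := 1) (m := k) hL hz hs
    (by rcases hc with rfl | rfl | rfl <;> rfl)
  have hY := profile_Y_of_mem_kite_left (p := 0) (m := k) hL hz hs
    (by rcases hc with rfl | rfl | rfl <;> rfl)
  have h : sectorMap L (ray c) z = v L 0 (outer (ray c)) z + (2 * √3) •
      ofFrame (ray c) (-profile L 0 (Y (ray c) z)) (profile L 1 (X (ray c) z)) := by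
    rcases hc with rfl | rfl | rfl <;> rfl
  have h3 := sqrt_three_mul_self
  have ht := pow_two_mul_eq k
  have e1 := thr_odd L 0
  have e2 := thr_even L 0
  simp only [mul_zero, zero_add, pow_zero, mul_one] at e1 e2
  rw [h, hX, hY]
  clear h hX hY hz hs
  simp only [zero_add, Nat.reduceAdd, e1, e2, shift, X, Y]
  clear e1 e2
  set G := ∑ i ∈ Finset.range k, t ^ (2 * i)
  clear_value G
  rw [t_eq] at ht
  ext i
  rcases hc with rfl | rfl | rfl <;> fin_cases i <;>
    simp [outer, ray, v, ofFrame, cosTab, sinTab, t_eq, ht] <;> clear ht <;> grind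

lemma sectorMap_eq_right_even {L : ℝ} (hL : 0 < L) {k : ℕ} {c : Cell} {z : Plane}
    (hc : c = .A ∨ c = .E ∨ c = .F) (hz : z ∈ kite L (ring k c) (ray c)) (hs : z ∈ sector (ray c + 1)) :
    sectorMap L (ray c + 1) z = v L k c z + shift L k := by
  have hX := profile_X_of_mem_kite_right (p := 1) (m := k) hL hz hs
    (by rcases hc with rfl | rfl | rfl <;> rfl)
  have hY := profile_Y_of_mem_kite_right (p := 0) (m := (k + 1)) hL hz hs
    (by rcases hc with rfl | rfl | rfl <;> rfl)
  have h : sectorMap L (ray c + 1) z = v L 0 (outer (ray c + 1)) z + (2 * √3) •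
      ofFrame (ray c + 1) (-profile L 0 (Y (ray c + 1) z)) (profile L 1 (X (ray c + 1) z)) := by
    rcases hc with rfl | rfl | rfl <;> rfl
  have h3 := sqrt_three_mul_self
  have ht := pow_two_mul_eq k
  have e1 := thr_odd L 0
  have e2 := thr_even L 0
  simp only [mul_zero, zero_add, pow_zero, mul_one] at e1 e2
  rw [h, hX, hY]
  clear h hX hY hz hs
  simp only [zero_add, Nat.reduceAdd, e1, e2, Finset.sum_range_succ, shift, X, Y]
  clear e1 e2
  set G := ∑ i ∈ Finset.range k, t ^ (2 * i)
  clear_value G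
  rw [t_eq] at ht
  ext i
  rcases hc with rfl | rfl | rfl <;> fin_cases i <;>
    simp [outer, ray, v, ofFrame, cosTab, sinTab, t_eq, ht] <;> clear ht <;> grind

lemma sectorMap_eq_right_odd {L : ℝ} (hL : 0 < L) {k : ℕ} {c : Cell} {z : Plane}
    (hc : c = .B ∨ c = .C ∨ c = .D) (hz : z ∈ kite L (ring k c) (ray c)) (hs : z ∈ sector (ray c + 1)) :
    sectorMap L (ray c + 1) z = v L k c z + shift L k := by
  have hX := profile_X_of_mem_kite_right (p := 0) (m := k) hL hz hs
    (by rcases hc with rfl | rfl | rfl <;> rfl)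
  have hY := profile_Y_of_mem_kite_right (p := 1) (m := k) hL hz hs
    (by rcases hc with rfl | rfl | rfl <;> rfl)
  have h : sectorMap L (ray c + 1) z = v L 0 (outer (ray c + 1)) z + (2 * √3) •
      ofFrame (ray c + 1) (-profile L 1 (Y (ray c + 1) z)) (profile L 0 (X (ray c + 1) z)) := by
    rcases hc with rfl | rfl | rfl <;> rfl
  have h3 := sqrt_three_mul_self
  have ht := pow_two_mul_eq k
  have e1 := thr_odd L 0
  have e2 := thr_even L 0
  simp only [mul_zero, zero_add, pow_zero, mul_one] at e1 e2
  rw [h, hX, hY]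
  clear h hX hY hz hs
  simp only [zero_add, Nat.reduceAdd, e1, e2, shift, X, Y]
  clear e1 e2
  set G := ∑ i ∈ Finset.range k, t ^ (2 * i)
  clear_value G
  rw [t_eq] at ht
  ext i
  rcases hc with rfl | rfl | rfl <;> fin_cases i <;>
    simp [outer, ray, v, ofFrame, cosTab, sinTab, t_eq, ht] <;> clear ht <;> grind

lemma disp_eq_of_mem_cell {L : ℝ} (hL : 0 < L) (ε : ℝ) {k : ℕ} {c : Cell} {z : Plane}
    (hz : z ∈ cell L k c) : disp L ε z = ε • (v L k c z + shift L k) := by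
  have hd := subset_closure (cell_subset_disk hL k c hz)
  have hk := cell_subset_kite hL k c hz
  have hc : (c = .A ∨ c = .E ∨ c = .F) ∨ (c = .B ∨ c = .C ∨ c = .D) := by
    cases c <;> simp
  rcases mem_sector_of_mem_kite hk with hs | hs
  · rw [disp_eq hL ε hd hs]
    rcases hc with hc | hc
    · rw [sectorMap_eq_left_even hL hc hk hs]
    · rw [sectorMap_eq_left_odd hL hc hk hs]
  · rw [disp_eq hL ε hd hs]
    rcases hc with hc | hc
    · rw [sectorMap_eq_right_even hL hc hk hs]
    · rw [sectorMap_eq_right_odd hL hc hk hs]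

lemma profile_zero {L : ℝ} (hL : 0 < L) (p : ℕ) :
    profile L p 0 = thr L (p + 1) / (1 - t ^ 2) := by
  have h : ∀ i, max (thr L (2 * i + p + 1) - max 0 0) 0 = thr L (p + 1) * (t ^ 2) ^ i := fun i => by
    rw [max_self, sub_zero, max_eq_left (thr_pos hL _).le, thr_two_mul_add]
  rw [profile]
  simp only [h]
  rw [tsum_mul_left, tsum_geometric_of_lt_one (by positivity)
    (pow_lt_one₀ t_pos.le t_lt_one two_ne_zero)]
  rfl

lemma disp_zero {L : ℝ} (hL : 0 < L) (ε : ℝ) :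
    disp L ε 0 = (ε * L / (1 - t ^ 2)) • !₂[√3 - 2, 1] := by
  have h0 : (0 : Plane) ∈ closure (disk L) :=
    subset_closure (Metric.mem_ball_self (radius_pos hL))
  have hs : (0 : Plane) ∈ sector 0 := by rw [mem_sector]; simp [X, Y]
  have h3 := sqrt_three_mul_self
  have e1 := thr_odd L 0
  have e2 := thr_even L 0
  simp only [mul_zero, zero_add, pow_zero, mul_one] at e1 e2
  rw [disp_eq hL ε h0 hs, sectorMap]
  have hX : X 0 0 = 0 := by simp [X]
  have hY : Y 0 0 = 0 := by simp [Y]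
  rw [hX, hY, profile_zero hL, profile_zero hL]
  ext i
  fin_cases i <;> simp [outer, v, ofFrame, cosTab, sinTab, e1, e2]
  · linear_combination (-ε * L / (1 - t ^ 2) * (2 / 3)) * h3
  · linear_combination (ε * L / (1 - t ^ 2) / 3) * h3

/-! ### The gradient on the cells -/

/-- The linear map of a matrix. -/
def linMap (M : Matrix (Fin 2) (Fin 2) ℝ) : Plane →ₗ[ℝ] Plane where
  toFun z := !₂[M 0 0 * z 0 + M 0 1 * z 1, M 1 0 * z 0 + M 1 1 * z 1]
  map_add' x y := by ext i; fin_cases i <;> simp <;> ring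
  map_smul' c x := by ext i; fin_cases i <;> simp <;> ring

/-- The unscaled displacement gradient on a cell. -/
def cellGrad (k : ℕ) : Cell → Matrix (Fin 2) (Fin 2) ℝ
  | .A => !![-1 / 2, (2 * k - 1 / 2) * √3; -√3 * (1 / 2 + 2 * k), 1 / 2]
  | .B => !![1, -√3 + 2 * k * √3; √3 - 2 * k * √3, -1]
  | .C => !![-1 / 2, √3 * (2 * k - 1 / 2); 3 * √3 / 2 - 2 * k * √3, 1 / 2]
  | .D => !![-1 / 2, 2 * k * √3 - 3 * √3 / 2; √3 / 2 - 2 * k * √3, 1 / 2]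
  | .E => !![-1 / 2, (1 / 2 + 2 * k) * √3; (1 / 2 - 2 * k) * √3, 1 / 2]
  | .F => !![1, 2 * √3 * k; -2 * k * √3, -1]

/-- The strain on a cell. -/
def cellStrain : Cell → Fin 3
  | .A => 2
  | .B => 0
  | .C => 1
  | .D => 2
  | .E => 1
  | .F => 0

lemma v_eq (L : ℝ) (k : ℕ) (c : Cell) (z : Plane) :
    v L k c z = linMap (cellGrad k c) z + v L k c 0 := by
  ext i
  cases c <;> fin_cases i <;> simp [v, linMap, cellGrad] <;> ring

lemma hasFDerivAt_disp {L : ℝ} (hL : 0 < L) (ε : ℝ) {k : ℕ} {c : Cell} {z : Plane}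
    (hz : z ∈ cell L k c) :
    HasFDerivAt (disp L ε) (ε • (linMap (cellGrad k c)).toContinuousLinearMap) z := by
  have h : HasFDerivAt (fun z => ε • ((linMap (cellGrad k c)).toContinuousLinearMap z +
      (v L k c 0 + shift L k))) (ε • (linMap (cellGrad k c)).toContinuousLinearMap) z :=
    ((linMap (cellGrad k c)).toContinuousLinearMap.hasFDerivAt.add_const _).const_smul ε
  refine h.congr_of_eventuallyEq ?_
  filter_upwards [(isOpen_cell hL k c).mem_nhds hz] with w hw
  rw [disp_eq_of_mem_cell hL ε hw, v_eq, add_assoc]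
  rfl

lemma grad_disp {L : ℝ} (hL : 0 < L) (ε : ℝ) {k : ℕ} {c : Cell} {z : Plane}
    (hz : z ∈ cell L k c) : grad (disp L ε) z = ε • cellGrad k c := by
  ext i j
  rw [grad, (hasFDerivAt_disp hL ε hz).fderiv]
  fin_cases i <;> fin_cases j <;> simp [linMap]

lemma symPart_cellGrad (ε : ℝ) (k : ℕ) (c : Cell) :
    symPart (ε • cellGrad k c) = strain ε (cellStrain c) := by
  ext i j
  cases c <;> fin_cases i <;> fin_cases j <;>
    simp [symPart, cellGrad, strain, cellStrain] <;> ring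

/-- Each ring inward adds the same rotation ε√3. The rotation vanishes on ring 1 and has the
opposite sign on ring 0, so the formula needs k ≥ 1. -/
lemma skewPart_cellGrad {ε : ℝ} (hε : 0 < ε) {k : ℕ} (hk : 1 ≤ k) (c : Cell) {i j : Fin 2}
    (hij : i ≠ j) : |skewPart (ε • cellGrad k c) i j| = ε * √3 * (ring k c - 1) := by
  have hk' : (1 : ℝ) ≤ k := by exact_mod_cast hk
  have h1 : 0 ≤ ε * √3 * (2 * k) := by positivity
  have h2 : 0 ≤ ε * √3 * (2 * k - 1) := mul_nonneg (by positivity) (by linarith)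
  have key : ∀ a b : ℝ, (a = b ∨ a = -b) → 0 ≤ b → |a| = b := by
    rintro a b (rfl | rfl) hb
    · exact abs_of_nonneg hb
    · rw [abs_neg, abs_of_nonneg hb]
  have h3 : (0 : ℝ) ≤ ε * √3 * (ring k c - 1) := by
    cases c <;> simp only [ring] <;> push_cast <;> linarith
  refine key _ _ ?_ h3
  fin_cases i <;> fin_cases j <;> simp at hij
  · left; cases c <;> simp [skewPart, cellGrad, ring] <;> ring
  · right; cases c <;> simp [skewPart, cellGrad, ring] <;> ring

lemma skewPart_bounds {ε : ℝ} (hε : 0 < ε) {k : ℕ} (hk : 1 ≤ k) (c : Cell) {i j : Fin 2}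
    (hij : i ≠ j) : ε * √3 * k ≤ |skewPart (ε • cellGrad k c) i j| ∧
      |skewPart (ε • cellGrad k c) i j| ≤ 2 * ε * √3 * k := by
  have hk' : (1 : ℝ) ≤ k := by exact_mod_cast hk
  have hs := mul_pos hε sqrt_three_pos
  have h1 : (2 * k : ℝ) ≤ ring k c := by exact_mod_cast le_ring k c
  have h2 : (ring k c : ℝ) ≤ 2 * k + 1 := by
    have : ring k c ≤ 2 * k + 1 := by cases c <;> simp [ring]
    exact_mod_cast this
  rw [skewPart_cellGrad hε hk c hij]
  constructor
  · exact mul_le_mul_of_nonneg_left (by linarith) hs.le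
  · have := mul_le_mul_of_nonneg_left (by linarith : (ring k c - 1 : ℝ) ≤ 2 * k) hs.le
    linarith

lemma strain_injective {ε : ℝ} (hε : 0 < ε) : Function.Injective (strain ε) := by
  have h3 := sqrt_three_pos
  intro i j h
  have h1 := congrFun (congrFun h 0) 0
  have h2 := congrFun (congrFun h 0) 1
  fin_cases i <;> fin_cases j <;> simp [strain, hε.ne'] at h1 h2 ⊢ <;> linarith

/-! ### The cells fill the disk -/

/-- The line is the frontier of a half-plane, and the frontier of a convex set is null. -/
lemma volume_X_eq (j : Fin 6) (c : ℝ) : volume {z : Plane | X j z = c} = 0 := by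
  have h := ((convex_Iic c).linear_preimage (linX j)).addHaar_frontier volume
  have h' := (isOpenMap_X j).preimage_frontier_eq_frontier_preimage (continuous_X j) (Set.Iic c)
  rw [frontier_Iic] at h'
  change volume (frontier (X j ⁻¹' Set.Iic c)) = 0 at h
  rw [← h'] at h
  exact h

lemma volume_Y_eq (j : Fin 6) (c : ℝ) : volume {z : Plane | Y j z = c} = 0 := by
  have h := ((convex_Iic c).linear_preimage (linY j)).addHaar_frontier volume
  have h' := (isOpenMap_Y j).preimage_frontier_eq_frontier_preimage (continuous_Y j) (Set.Iic c)
  rw [frontier_Iic] at h'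
  change volume (frontier (Y j ⁻¹' Set.Iic c)) = 0 at h
  rw [← h'] at h
  exact h

lemma volume_disk_diff_cells {L : ℝ} (hL : 0 < L) :
    volume (disk L \ ⋃ k, ⋃ c, cell L k c) = 0 := by
  have hg : volume (gridLines L) = 0 := by
    simp only [gridLines, measure_iUnion_null_iff, measure_union_null_iff, volume_X_eq,
      volume_Y_eq, and_self, implies_true]
  refine measure_mono_null (t := gridLines L ∪ {0}) ?_ (measure_union_null hg (measure_singleton _))
  rintro z ⟨hz, hn⟩
  by_contra h
  rw [Set.mem_union, not_or] at h
  obtain ⟨k, c, hc⟩ := exists_mem_cell hL hz h.2 h.1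
  exact hn (Set.mem_iUnion.2 ⟨k, Set.mem_iUnion.2 ⟨c, hc⟩⟩)

lemma measurableSet_disk (L : ℝ) : MeasurableSet (disk L) := Metric.isOpen_ball.measurableSet

lemma ae_mem_cell {L : ℝ} (hL : 0 < L) :
    ∀ᵐ z ∂(volume.restrict (disk L)), ∃ k c, z ∈ cell L k c := by
  rw [ae_restrict_iff' (measurableSet_disk L)]
  filter_upwards [measure_eq_zero_iff_ae_notMem.1 (volume_disk_diff_cells hL)] with z hz hd
  by_contra h
  exact hz ⟨hd, fun h' => h <| by simpa only [Set.mem_iUnion] using h'⟩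

/-! ### The areas of the phases -/

/-- The union of the cells with a given strain. -/
def strainCells (L : ℝ) (i : Fin 3) : Set Plane :=
  ⋃ k, ⋃ c, ⋃ (_ : cellStrain c = i), cell L k c

lemma mem_strainCells {L : ℝ} {i : Fin 3} {z : Plane} :
    z ∈ strainCells L i ↔ ∃ k c, cellStrain c = i ∧ z ∈ cell L k c := by
  simp only [strainCells, Set.mem_iUnion, exists_prop]

lemma isOpen_strainCells {L : ℝ} (hL : 0 < L) (i : Fin 3) : IsOpen (strainCells L i) :=
  isOpen_iUnion fun k => isOpen_iUnion fun c => isOpen_iUnion fun _ => isOpen_cell hL k c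

lemma strainCells_subset_phase {L ε : ℝ} (hL : 0 < L) (i : Fin 3) :
    strainCells L i ⊆ phase ε (disk L) (disp L ε) i := by
  intro z hz
  obtain ⟨k, c, rfl, hc⟩ := mem_strainCells.1 hz
  refine ⟨cell_subset_disk hL k c hc, (hasFDerivAt_disp hL ε hc).differentiableAt, ?_⟩
  rw [grad_disp hL ε hc, symPart_cellGrad]

/-- Points of the phase outside its own cells lie in no cell at all, since the three strains are
distinct. They therefore form a null set. -/
lemma volume_phase_eq {L ε : ℝ} (hL : 0 < L) (hε : 0 < ε) (i : Fin 3) :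
    volume (phase ε (disk L) (disp L ε) i) = volume (strainCells L i) := by
  refine (measure_eq_measure_of_null_sdiff (strainCells_subset_phase hL i) ?_).symm
  refine measure_mono_null ?_ (volume_disk_diff_cells hL)
  rintro z ⟨hz, hn⟩
  refine ⟨hz.1, fun h => hn ?_⟩
  simp only [Set.mem_iUnion] at h
  obtain ⟨k, c, hc⟩ := h
  refine mem_strainCells.2 ⟨k, c, strain_injective hε ?_, hc⟩
  rw [← hz.2.2, grad_disp hL ε hc, symPart_cellGrad]

/-- Rotation by `-2π/3` permutes the cells of a level. -/
def rotCell : Cell → Cell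
  | .A => .F
  | .F => .E
  | .E => .A
  | .B => .C
  | .C => .D
  | .D => .B

lemma cell_rotCell {L : ℝ} (hL : 0 < L) (k : ℕ) (c : Cell) :
    cell L k (rotCell c) = rot (-(2 * Real.pi / 3)) '' cell L k c := by
  cases c <;> exact cell_eq_image_rot hL rfl rfl

lemma rotCell_surjective : Function.Surjective rotCell := by
  intro c
  cases c
  exacts [⟨.E, rfl⟩, ⟨.D, rfl⟩, ⟨.B, rfl⟩, ⟨.C, rfl⟩, ⟨.F, rfl⟩, ⟨.A, rfl⟩]

lemma cellStrain_rotCell (c : Cell) : cellStrain (rotCell c) = cellStrain c + 1 := by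
  cases c <;> rfl

/-- Rotation by -2π/3 preserves area and carries the cells of one strain onto those of the next. -/
lemma volume_strainCells_succ {L : ℝ} (hL : 0 < L) (i : Fin 3) :
    volume (strainCells L (i + 1)) = volume (strainCells L i) := by
  have h : strainCells L (i + 1) = rotEquiv (-(2 * Real.pi / 3)) '' strainCells L i := by
    ext z
    simp only [mem_strainCells, Set.mem_image, rotEquiv_apply]
    constructor
    · rintro ⟨k, c, hi, hc⟩
      obtain ⟨c, rfl⟩ := rotCell_surjective c
      rw [cellStrain_rotCell, add_left_inj] at hi
      rw [cell_rotCell hL] at hc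
      obtain ⟨w, hw, rfl⟩ := hc
      exact ⟨w, ⟨k, c, hi, hw⟩, rfl⟩
    · rintro ⟨w, ⟨k, c, hi, hc⟩, rfl⟩
      refine ⟨k, rotCell c, by rw [cellStrain_rotCell, hi], ?_⟩
      rw [cell_rotCell hL]
      exact ⟨w, hc, rfl⟩
  rw [h, LinearIsometryEquiv.image_eq_preimage_symm]
  exact (rotEquiv (-(2 * Real.pi / 3))).symm.measurePreserving.measure_preimage
    (isOpen_strainCells hL i).measurableSet.nullMeasurableSet

lemma sum_volume_strainCells {L : ℝ} (hL : 0 < L) :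
    ∑ i, volume (strainCells L i) = volume (disk L) := by
  rw [← tsum_fintype (L := SummationFilter.unconditional _), ← measure_iUnion ?_ fun i => (isOpen_strainCells hL i).measurableSet]
  · refine measure_eq_measure_of_null_sdiff ?_ (measure_mono_null ?_ (volume_disk_diff_cells hL))
    · refine Set.iUnion_subset fun i z hz => ?_
      obtain ⟨k, c, -, hc⟩ := mem_strainCells.1 hz
      exact cell_subset_disk hL k c hc
    · rintro z ⟨hz, hn⟩
      refine ⟨hz, fun h => hn ?_⟩
      simp only [Set.mem_iUnion] at h
      obtain ⟨k, c, hc⟩ := h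
      exact Set.mem_iUnion.2 ⟨cellStrain c, mem_strainCells.2 ⟨k, c, rfl, hc⟩⟩
  · intro i j hij
    refine Set.disjoint_left.2 fun z hz hz' => hij ?_
    obtain ⟨k, c, rfl, hc⟩ := mem_strainCells.1 hz
    obtain ⟨k', c', rfl, hc'⟩ := mem_strainCells.1 hz'
    by_contra hne
    have h : ((k, c) : ℕ × Cell) ≠ (k', c') := fun e => hne (by rw [(Prod.mk.inj e).2])
    exact Set.disjoint_left.1 (pairwise_disjoint_cell hL h) hc hc'

lemma volume_phase {L ε : ℝ} (hL : 0 < L) (hε : 0 < ε) (i : Fin 3) :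
    volume (phase ε (disk L) (disp L ε) i) = ENNReal.ofReal (Real.pi / 3 * radius L ^ 2) := by
  have h1 := volume_strainCells_succ hL 0
  have h2 := volume_strainCells_succ hL 1
  have hsum := sum_volume_strainCells hL
  simp only [Fin.isValue, zero_add, Fin.reduceAdd] at h1 h2
  have hi : volume (strainCells L i) = volume (strainCells L 0) := by
    fin_cases i
    · rfl
    · exact h1
    · exact h2.trans h1
  rw [Fin.sum_univ_three, h2, h1, disk, EuclideanSpace.volume_ball_fin_two] at hsum
  rw [volume_phase_eq hL hε, hi]
  have hr := (radius_pos hL).le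
  have h3 : ENNReal.ofReal (radius L) ^ 2 * ENNReal.ofReal Real.pi =
      3 * ENNReal.ofReal (Real.pi / 3 * radius L ^ 2) := by
    rw [← ENNReal.ofReal_pow hr, ← ENNReal.ofReal_mul (by positivity),
      show (3 : ℝ≥0∞) = ENNReal.ofReal 3 by simp, ← ENNReal.ofReal_mul (by norm_num)]
    congr 1
    ring
  rw [h3] at hsum
  refine (ENNReal.mul_right_inj (by norm_num : (3 : ℝ≥0∞) ≠ 0) (by norm_num)).1 ?_
  rw [← hsum]
  ring

/-! ### Integrability of the gradient -/

lemma abs_cellGrad_le (k : ℕ) (c : Cell) (i j : Fin 2) : |cellGrad k c i j| ≤ 4 * (k + 1) := by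
  have h3 := sqrt_three_mul_self
  have h0 := sqrt_three_pos
  have h1 : √3 ≤ (2 : ℝ) := by nlinarith
  have hk : (0 : ℝ) ≤ k := Nat.cast_nonneg k
  have h4 := mul_nonneg hk h0.le
  have h5 := mul_le_mul_of_nonneg_left h1 hk
  rw [abs_le]
  cases c <;> fin_cases i <;> fin_cases j <;> simp [cellGrad] <;> constructor <;> linarith

lemma measurable_grad (u : Plane → Plane) (i j : Fin 2) : Measurable fun z => grad u z i j := by
  have h := measurable_fderiv_apply_const ℝ u (EuclideanSpace.single j (1 : ℝ))
  have h2 : Measurable fun w : Plane => w i := by fun_prop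
  exact h2.comp h

lemma volume_iUnion_cell_le {L : ℝ} (hL : 0 < L) (k : ℕ) :
    volume (⋃ c, cell L k c) ≤ ENNReal.ofReal ((4 * thr L (2 * k)) ^ 2 * Real.pi) := by
  have h1 : ⋃ c, cell L k c ⊆ Metric.ball (0 : Plane) (4 * thr L (2 * k)) := by
    refine Set.iUnion_subset fun c z hz => mem_ball_zero_iff.2 ?_
    have h2 := norm_lt_of_mem_kite hL (cell_subset_kite hL k c hz)
    have h3 := (thr_strictAnti hL).antitone (le_ring k c)
    linarith
  refine (measure_mono h1).trans ?_
  have h4 := thr_pos hL (2 * k)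
  rw [EuclideanSpace.volume_ball_fin_two, ← ENNReal.ofReal_pow (by positivity),
    ← ENNReal.ofReal_mul (by positivity)]

lemma summable_level_bound (L ε : ℝ) (q : ℕ) :
    Summable fun k : ℕ => (ε * (4 * (k + 1))) ^ q * ((4 * thr L (2 * k)) ^ 2 * Real.pi) := by
  have ht : ‖t ^ 4‖ < 1 := by
    rw [Real.norm_of_nonneg (pow_nonneg t_pos.le 4)]
    exact pow_lt_one₀ t_pos.le t_lt_one (by norm_num)
  have h := (summable_nat_add_iff (f := fun n : ℕ => (n : ℝ) ^ q * (t ^ 4) ^ n) 1).2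
    (summable_pow_mul_geometric_of_norm_lt_one q ht)
  have key : ∀ k : ℕ, (ε * (4 * (k + 1))) ^ q * ((4 * thr L (2 * k)) ^ 2 * Real.pi) =
      (ε * 4) ^ q * (16 * thr L 0 ^ 2 * Real.pi) / t ^ 4 *
        (((k + 1 : ℕ) : ℝ) ^ q * (t ^ 4) ^ (k + 1)) := by
    intro k
    have h4 : (t ^ 4) ^ (k + 1) / t ^ 4 = (t ^ (2 * k)) ^ 2 := by
      rw [pow_succ, mul_div_cancel_right₀ _ (pow_pos t_pos 4).ne', ← pow_mul, ← pow_mul]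
      congr 1
      ring
    have h5 : (ε * (4 * ((k : ℝ) + 1))) ^ q = (ε * 4) ^ q * ((k + 1 : ℕ) : ℝ) ^ q := by
      rw [← mul_pow, mul_assoc]
      push_cast
      rfl
    have h6 : thr L (2 * k) = t ^ (2 * k) * thr L 0 := by
      have := thr_add L 0 (2 * k)
      rwa [zero_add] at this
    rw [h5, h6]
    generalize (ε * 4) ^ q = B
    generalize ((k + 1 : ℕ) : ℝ) ^ q = A
    generalize (t ^ 4) ^ (k + 1) = T at *
    generalize t ^ (2 * k) = S at *
    generalize thr L 0 = C
    generalize t ^ 4 = D at *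
    linear_combination (-B * (16 * C ^ 2 * Real.pi) * A) * h4
  simp only [key]
  exact h.mul_left _

lemma ae_disk_le_iUnion {L : ℝ} (hL : 0 < L) :
    disk L ≤ᵐ[volume] ⋃ k, ⋃ c, cell L k c :=
  ae_le_set.2 (volume_disk_diff_cells hL)

instance (L : ℝ) : IsFiniteMeasure (volume.restrict (disk L)) :=
  ⟨by rw [Measure.restrict_apply_univ]; exact measure_ball_lt_top⟩

/-- The measure is finite, so an integer exponent q > p suffices. Summing over levels leaves a
polynomial of degree q in k against the geometric factor t^(4k). -/
lemma memLp_grad_disp {L ε : ℝ} (hL : 0 < L) (hε : 0 < ε) (i j : Fin 2) {p : ℝ≥0∞} (hp : p ≠ ⊤) :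
    MemLp (fun z => grad (disp L ε) z i j) p (volume.restrict (disk L)) := by
  obtain ⟨q, hq⟩ := ENNReal.exists_nat_gt hp
  refine MemLp.mono_exponent (q := q) ⟨(measurable_grad _ i j).aestronglyMeasurable, ?_⟩ hq.le
  have hq0 : (q : ℝ≥0∞) ≠ 0 := (pos_of_gt hq).ne'
  rw [eLpNorm_lt_top_iff_lintegral_rpow_enorm_lt_top hq0 (ENNReal.natCast_ne_top q)]
  simp only [ENNReal.toReal_natCast, ENNReal.rpow_natCast]
  refine (lintegral_mono_set' (ae_disk_le_iUnion hL)).trans_lt ?_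
  refine (lintegral_iUnion_le _ _).trans_lt ?_
  refine lt_of_le_of_lt (ENNReal.tsum_le_tsum fun k => ?_)
    (summable_level_bound L ε q).tsum_ofReal_lt_top
  have hm : MeasurableSet (⋃ c, cell L k c) :=
    (isOpen_iUnion fun c => isOpen_cell hL k c).measurableSet
  calc ∫⁻ z in ⋃ c, cell L k c, ‖grad (disp L ε) z i j‖ₑ ^ q
      ≤ ∫⁻ _ in ⋃ c, cell L k c, ENNReal.ofReal ((ε * (4 * (k + 1))) ^ q) := by
        refine setLIntegral_mono' hm fun z hz => ?_
        obtain ⟨c, hc⟩ := Set.mem_iUnion.1 hz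
        rw [grad_disp hL ε hc, Matrix.smul_apply, smul_eq_mul,
          ENNReal.ofReal_pow (by positivity)]
        gcongr
        rw [Real.enorm_eq_ofReal_abs, abs_mul, abs_of_pos hε]
        exact ENNReal.ofReal_le_ofReal (mul_le_mul_of_nonneg_left (abs_cellGrad_le k c i j) hε.le)
    _ ≤ _ := by
        rw [setLIntegral_const, ENNReal.ofReal_mul (by positivity)]
        gcongr
        exact volume_iUnion_cell_le hL k

lemma integrableOn_grad_disp {L ε : ℝ} (hL : 0 < L) (hε : 0 < ε) (i j : Fin 2) :
    IntegrableOn (fun z => grad (disp L ε) z i j) (disk L) :=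
  memLp_one_iff_integrable.1 (memLp_grad_disp hL hε i j ENNReal.one_ne_top)

lemma exists_bound_disp {L : ℝ} (hL : 0 < L) (ε : ℝ) (i : Fin 2) :
    ∃ C, ∀ z ∈ closure (disk L), ‖disp L ε z i‖ ≤ C := by
  have hc : IsCompact (closure (disk L)) := Metric.isBounded_ball.isCompact_closure
  have h2 : Continuous fun w : Plane => w i := by fun_prop
  exact hc.exists_bound_of_continuousOn (h2.comp_continuousOn (continuousOn_disp hL ε))

lemma memLp_disp {L : ℝ} (hL : 0 < L) (ε : ℝ) (i : Fin 2) (p : ℝ≥0∞) :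
    MemLp (fun z => disp L ε z i) p (volume.restrict (disk L)) := by
  have hm := measurableSet_disk L
  have h2 : Continuous fun w : Plane => w i := by fun_prop
  obtain ⟨C, hC⟩ := exists_bound_disp hL ε i
  refine MemLp.of_bound ((h2.comp_continuousOn
    ((continuousOn_disp hL ε).mono subset_closure)).aestronglyMeasurable hm) C ?_
  exact (ae_restrict_iff' hm).2 (Filter.Eventually.of_forall fun z hz => hC z (subset_closure hz))

lemma integrableOn_disp {L : ℝ} (hL : 0 < L) (ε : ℝ) (i : Fin 2) :
    IntegrableOn (fun z => disp L ε z i) (disk L) :=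
  memLp_one_iff_integrable.1 (memLp_disp hL ε i 1)

/-! ### Continuous selections of Lipschitz functions -/

/-- Induction on the set of branches. Let c and d be the first and last points where g agrees with
the branch h i. Between them the increment of g is that of h i, and outside [c, d] only the
remaining branches occur. -/
lemma abs_sub_le_of_selection {ι : Type*} {K : ℝ} {h : ι → ℝ → ℝ}
    (hh : ∀ i a b, |h i b - h i a| ≤ K * |b - a|) {g : ℝ → ℝ} (hg : Continuous g) (s : Finset ι) :
    ∀ a b, a ≤ b → (∀ x ∈ Set.Ioo a b, ∃ i ∈ s, g x = h i x) → |g b - g a| ≤ K * (b - a) := by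
  classical
  induction s using Finset.induction_on with
  | empty =>
    intro a b hab hx
    rcases hab.eq_or_lt with rfl | hlt
    · simp
    · obtain ⟨x, hx'⟩ := Set.nonempty_Ioo.2 hlt
      obtain ⟨i, hi, -⟩ := hx x hx'
      simp at hi
  | insert i s his ih =>
    intro a b hab hx
    have hcont : Continuous (h i) := by
      refine (LipschitzWith.of_dist_le' (K := K) fun x y => ?_).continuous
      rw [Real.dist_eq, Real.dist_eq]
      exact hh i y x
    have hC : IsCompact (Set.Icc a b ∩ {x | g x = h i x}) :=
      isCompact_Icc.inter_right (isClosed_eq hg hcont)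
    have restrict : ∀ c d, a ≤ c → d ≤ b → (∀ x ∈ Set.Ioo c d, x ∉ Set.Icc a b ∩ {x | g x = h i x}) →
        ∀ x ∈ Set.Ioo c d, ∃ i ∈ s, g x = h i x := by
      intro c d hc hd hn x hxcd
      obtain ⟨i', hi', e⟩ := hx x ⟨hc.trans_lt hxcd.1, hxcd.2.trans_le hd⟩
      rcases Finset.mem_insert.1 hi' with rfl | hi'
      · exact absurd ⟨⟨hc.trans hxcd.1.le, hxcd.2.le.trans hd⟩, e⟩ (hn x hxcd)
      · exact ⟨i', hi', e⟩
    rcases (Set.Icc a b ∩ {x | g x = h i x}).eq_empty_or_nonempty with he | hne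
    · exact ih a b hab (restrict a b le_rfl le_rfl fun x _ hx => by rw [he] at hx; exact hx)
    · obtain ⟨c, hc, hcmin⟩ := hC.exists_isLeast hne
      obtain ⟨d, hd, hdmax⟩ := hC.exists_isGreatest hne
      have h1 := ih a c hc.1.1 (restrict a c le_rfl hc.1.2 fun x hx hx' =>
        absurd (hcmin hx') (not_le.2 hx.2))
      have h2 := ih d b hd.1.2 (restrict d b hd.1.1 le_rfl fun x hx hx' =>
        absurd (hdmax hx') (not_le.2 hx.1))
      have h3 := hh i c d
      have hcd : c ≤ d := hcmin hd
      rw [abs_of_nonneg (sub_nonneg.2 hcd)] at h3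
      have hc2 : g c = h i c := hc.2
      have hd2 : g d = h i d := hd.2
      rw [← hc2, ← hd2] at h3
      calc |g b - g a| = |(g b - g d) + (g d - g c) + (g c - g a)| := by ring_nf
        _ ≤ |g b - g d| + |g d - g c| + |g c - g a| := abs_add_three _ _ _
        _ ≤ K * (b - a) := by linarith

lemma lipschitzWith_of_selection {E ι : Type*} [NormedAddCommGroup E] [NormedSpace ℝ E]
    [Fintype ι] {K : NNReal} {h : ι → E → ℝ} (hh : ∀ i, LipschitzWith K (h i)) {f : E → ℝ}
    (hf : Continuous f) (hsel : ∀ x, ∃ i, f x = h i x) : LipschitzWith K f := by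
  refine LipschitzWith.of_dist_le_mul fun y x => ?_
  have key := abs_sub_le_of_selection (K := K * ‖y - x‖)
    (h := fun i (s : ℝ) => h i (x + s • (y - x))) (g := fun s => f (x + s • (y - x)))
    (fun i a b => ?_) (by fun_prop) Finset.univ 0 1 zero_le_one
    (fun s _ => by obtain ⟨i, hi⟩ := hsel (x + s • (y - x)); exact ⟨i, Finset.mem_univ i, hi⟩)
  · simpa [Real.dist_eq, dist_eq_norm] using key
  · have := (hh i).dist_le_mul (x + b • (y - x)) (x + a • (y - x))
    rw [Real.dist_eq, dist_eq_norm, add_sub_add_left_eq_sub, ← sub_smul, norm_smul,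
      Real.norm_eq_abs] at this
    linarith

/-! ### Lipschitz functions -/

/-- Lipschitz continuity with an unspecified constant. -/
def Lip {E : Type*} [PseudoEMetricSpace E] (f : E → ℝ) : Prop := ∃ K, LipschitzWith K f

section
variable {E : Type*} [NormedAddCommGroup E] {f g : E → ℝ}

lemma Lip.add (hf : Lip f) (hg : Lip g) : Lip fun x => f x + g x := by
  obtain ⟨K, hK⟩ := hf
  obtain ⟨K', hK'⟩ := hg
  exact ⟨_, hK.add hK'⟩

lemma Lip.neg (hf : Lip f) : Lip fun x => -f x := by
  obtain ⟨K, hK⟩ := hf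
  exact ⟨_, hK.neg⟩

lemma Lip.sub (hf : Lip f) (hg : Lip g) : Lip fun x => f x - g x := by
  obtain ⟨K, hK⟩ := hf
  obtain ⟨K', hK'⟩ := hg
  exact ⟨_, hK.sub hK'⟩

lemma lip_const (c : ℝ) : Lip fun _ : E => c := ⟨0, LipschitzWith.const c⟩

lemma Lip.max_const (hf : Lip f) (c : ℝ) : Lip fun x => max (f x) c := by
  obtain ⟨K, hK⟩ := hf
  exact ⟨_, hK.max_const c⟩

lemma Lip.const_mul (hf : Lip f) (c : ℝ) : Lip fun x => c * f x := by
  obtain ⟨K, hK⟩ := hf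
  refine ⟨Real.nnabs c * K, LipschitzWith.of_dist_le_mul fun x y => ?_⟩
  rw [Real.dist_eq, ← mul_sub, abs_mul, NNReal.coe_mul, Real.coe_nnabs, mul_assoc, ← Real.dist_eq]
  exact mul_le_mul_of_nonneg_left (hK.dist_le_mul x y) (abs_nonneg c)

lemma lip_sum {ι : Type*} (s : Finset ι) {f : ι → E → ℝ} (hf : ∀ i, Lip (f i)) :
    Lip fun x => ∑ i ∈ s, f i x := by
  classical
  induction s using Finset.induction_on with
  | empty => simpa using lip_const 0
  | insert i s hi ih =>
    simp only [Finset.sum_insert hi]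
    exact (hf i).add ih

lemma Lip.mul_of_hasCompactSupport (hf : Lip f) (hg : Lip g) (h : HasCompactSupport g) :
    Lip fun x => f x * g x := by
  obtain ⟨K, hK⟩ := hf
  obtain ⟨K', hK'⟩ := hg
  obtain ⟨B, hB⟩ := h.exists_bound_of_continuous hK'.continuous
  obtain ⟨A, hA⟩ := h.isCompact.exists_bound_of_continuousOn hK.continuous.continuousOn
  have hB0 : 0 ≤ max B 0 := le_max_right _ _
  have hA0 : 0 ≤ max A 0 := le_max_right _ _
  have key : ∀ x y, y ∈ tsupport g →
      |f x * g x - f y * g y| ≤ (max A 0 * K' + K * max B 0) * dist x y := by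
    intro x y hy
    have h1 : |f y| ≤ max A 0 := (hA y hy).trans (le_max_left _ _)
    have h2 : |g x| ≤ max B 0 := (hB x).trans (le_max_left _ _)
    have h3 : |g x - g y| ≤ K' * dist x y := hK'.dist_le_mul x y
    have h4 : |f x - f y| ≤ K * dist x y := hK.dist_le_mul x y
    calc |f x * g x - f y * g y| = |f y * (g x - g y) + (f x - f y) * g x| := by ring_nf
      _ ≤ |f y| * |g x - g y| + |f x - f y| * |g x| := by
        rw [← abs_mul, ← abs_mul]; exact abs_add_le _ _
      _ ≤ max A 0 * (K' * dist x y) + K * dist x y * max B 0 := by gcongr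
      _ = _ := by ring
  refine ⟨Real.toNNReal (max A 0 * K' + K * max B 0), LipschitzWith.of_dist_le_mul fun x y => ?_⟩
  rw [Real.coe_toNNReal _ (by positivity), Real.dist_eq]
  by_cases hy : y ∈ tsupport g
  · exact key x y hy
  by_cases hx : x ∈ tsupport g
  · rw [abs_sub_comm, dist_comm]; exact key y x hx
  · rw [image_eq_zero_of_notMem_tsupport hx, image_eq_zero_of_notMem_tsupport hy]
    simp only [mul_zero, sub_zero, abs_zero]
    positivity

end

/-! ### Lipschitz continuity away from the origin -/

lemma lip_linear (l : Plane →ₗ[ℝ] ℝ) : Lip l :=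
  ⟨_, l.toContinuousLinearMap.lipschitz⟩

lemma lip_X (j : Fin 6) : Lip (X j) := lip_linear (linX j)

lemma lip_Y (j : Fin 6) : Lip (Y j) := lip_linear (linY j)

lemma lip_v (L : ℝ) (k : ℕ) (c : Cell) (i : Fin 2) : Lip fun z => v L k c z i := by
  have h0 : Lip fun z : Plane => z 0 := by
    have e : X 0 = fun z => z 0 := funext fun z => (frame_eq z).1.1
    exact e ▸ lip_X 0
  have h1 : Lip fun z : Plane => z 1 := by
    have e : Y 0 = fun z => z 1 := funext fun z => (frame_eq z).2.1
    exact e ▸ lip_Y 0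
  have h : (fun z => v L k c z i) =
      fun z : Plane => cellGrad k c i 0 * z 0 + cellGrad k c i 1 * z 1 + v L k c 0 i := by
    ext z
    rw [v_eq]
    fin_cases i <;> rfl
  rw [h]
  exact ((h0.const_mul _).add (h1.const_mul _)).add (lip_const _)

lemma lip_profile_max {L : ℝ} (hL : 0 < L) (p : ℕ) {r : ℝ} (hr : 0 < r) {f : Plane → ℝ}
    (hf : Lip f) : Lip fun z => profile L p (max (f z) r) := by
  obtain ⟨N, hN⟩ := ((tendsto_thr L).eventually (gt_mem_nhds hr)).exists_forall_of_atTop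
  have h : thr L (2 * N + p + 1) ≤ r := (hN _ (by omega)).le
  simp only [profile_max_eq_sum hL h]
  exact lip_sum _ fun i => ((lip_const _).sub (hf.max_const r)).max_const 0

/-- The displacement in a sector, modified near the origin so as to be Lipschitz. -/
def truncMap (L r : ℝ) (j : Fin 6) (z : Plane) : Plane :=
  v L 0 (outer j) z + (2 * √3) • ofFrame j (-profile L ((j.val + 1) % 2) (max (Y j z) r))
    (profile L (j.val % 2) (max (X j z) r))

lemma lip_truncMap {L : ℝ} (hL : 0 < L) {r : ℝ} (hr : 0 < r) (j : Fin 6) (i : Fin 2) :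
    Lip fun z => truncMap L r j z i := by
  have h1 := lip_v L 0 (outer j) i
  have h2 := (lip_profile_max hL ((j.val + 1) % 2) hr (lip_Y j)).neg
  have h3 := lip_profile_max hL (j.val % 2) hr (lip_X j)
  fin_cases i
  · exact h1.add (((h2.const_mul (cosTab j)).sub (h3.const_mul (sinTab j))).const_mul (2 * √3))
  · exact h1.add (((h2.const_mul (sinTab j)).add (h3.const_mul (cosTab j))).const_mul (2 * √3))

lemma frame_ge_of_norm_ge {j : Fin 6} {z : Plane} {δ : ℝ} (hδ : 0 ≤ δ) (hz : z ∈ sector j)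
    (h : δ ≤ ‖z‖) : δ / 5 ≤ X j z ∧ δ / 5 ≤ Y j z := by
  have h1 := pow_le_pow_left₀ hδ h 2
  rw [norm_sq_eq_frame j] at h1
  obtain ⟨hX, hY⟩ := nonneg_of_mem_sector hz
  obtain ⟨h2, h3⟩ := frame_bound_of_mem_sector hz
  have hs : (2 : ℝ) + √3 ≤ 4 := by nlinarith [sqrt_three_mul_self, sqrt_three_pos]
  have h4 : Y j z ≤ 4 * X j z := h2.trans (mul_le_mul_of_nonneg_right hs hX)
  have h5 : X j z ≤ 4 * Y j z := h3.trans (mul_le_mul_of_nonneg_right hs hY)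
  have h6 := pow_le_pow_left₀ hY h4 2
  have h7 := pow_le_pow_left₀ hX h5 2
  -- The sector gives ‖z‖² ≤ (1 + 4²) X², and likewise for Y, and 17 ≤ 25.
  constructor
  · refine le_of_sq_le_sq ?_ hX
    nlinarith
  · refine le_of_sq_le_sq ?_ hY
    nlinarith

lemma truncMap_eq {L : ℝ} {j : Fin 6} {z : Plane} {δ : ℝ} (hδ : 0 ≤ δ) (hz : z ∈ sector j)
    (h : δ ≤ ‖z‖) : truncMap L (δ / 5) j z = sectorMap L j z := by
  obtain ⟨h1, h2⟩ := frame_ge_of_norm_ge hδ hz h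
  rw [truncMap, sectorMap, max_eq_left h1, max_eq_left h2]

/-- Away from the origin the profiles are finite sums, so u coincides on each sector with the
globally Lipschitz `truncMap`. The product with g is thus a continuous selection of six Lipschitz
functions. -/
lemma lipschitz_disp_mul {L : ℝ} (hL : 0 < L) (ε : ℝ) (i : Fin 2) {g : Plane → ℝ} (hg : Lip g)
    (hc : HasCompactSupport g) (hs : tsupport g ⊆ disk L) {δ : ℝ} (hδ : 0 < δ)
    (h0 : ∀ z, ‖z‖ < δ → g z = 0) : Lip fun z => disp L ε z i * g z := by
  have h1 : ∀ j, Lip fun z => ε * truncMap L (δ / 5) j z i * g z := fun j =>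
    ((lip_truncMap hL (by positivity) j i).const_mul ε).mul_of_hasCompactSupport hg hc
  choose K hK using h1
  have hgc : Continuous g := hg.choose_spec.continuous
  have hw : Continuous fun w : Plane => w i := by fun_prop
  have hcont : Continuous fun z => disp L ε z i * g z := by
    refine continuous_of_tsupport fun z hz => ?_
    have hz' : z ∈ disk L := hs (closure_mono (Function.support_mul_subset_right _ _) hz)
    exact ((hw.comp_continuousOn ((continuousOn_disp hL ε).mono subset_closure)).continuousAt
      (Metric.isOpen_ball.mem_nhds hz')).mul hgc.continuousAt
  refine ⟨Finset.univ.sup K, lipschitzWith_of_selection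
    (fun j => (hK j).weaken (Finset.le_sup (Finset.mem_univ j))) hcont fun z => ?_⟩
  obtain ⟨j, hj⟩ := exists_mem_sector z
  refine ⟨j, ?_⟩
  by_cases hz : g z = 0
  · rw [hz, mul_zero, mul_zero]
  · have hd : z ∈ closure (disk L) :=
      subset_closure (hs (subset_tsupport g (Function.mem_support.2 hz)))
    have hn : δ ≤ ‖z‖ := by
      by_contra! h
      exact hz (h0 z h)
    rw [disp_eq hL ε hd hj, truncMap_eq hδ.le hj hn]
    rfl

/-! ### The weak gradient -/

/-- Integration by parts for Lipschitz functions, taken against the constant 1. -/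
lemma integral_lineDeriv_eq_zero {f : Plane → ℝ} (hf : Lip f) (hc : HasCompactSupport f)
    (w : Plane) : ∫ z, lineDeriv ℝ f z w = 0 := by
  obtain ⟨K, hK⟩ := hf
  have h := LipschitzWith.integral_lineDeriv_mul_eq (μ := volume)
    (LipschitzWith.const (1 : ℝ)) hK hc (-w)
  rw [neg_neg] at h
  have h0 : ∀ z, lineDeriv ℝ (fun _ : Plane => (1 : ℝ)) z (-w) = 0 := fun z => by
    simp [lineDeriv]
  simpa [h0] using h.symm

lemma integral_grad_mul_add_eq_zero {L : ℝ} (hL : 0 < L) (ε : ℝ) (i j : Fin 2) {g : Plane → ℝ}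
    (hg : ContDiff ℝ ∞ g) (hc : HasCompactSupport g) (hs : tsupport g ⊆ disk L) {δ : ℝ}
    (hδ : 0 < δ) (h0 : ∀ z, ‖z‖ < δ → g z = 0) :
    ∫ z in disk L, (grad (disp L ε) z i j * g z +
      disp L ε z i * fderiv ℝ g z (EuclideanSpace.single j (1 : ℝ))) = 0 := by
  have hglip : Lip g := by
    exact hg.lipschitzWith_of_hasCompactSupport hc (by simp)
  have hlip := lipschitz_disp_mul hL ε i hglip hc hs hδ h0
  have hcs : HasCompactSupport fun z => disp L ε z i * g z := hc.mul_left
  have hset : ∫ z in disk L, lineDeriv ℝ (fun z => disp L ε z i * g z) z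
      (EuclideanSpace.single j (1 : ℝ)) = ∫ z, lineDeriv ℝ (fun z => disp L ε z i * g z) z
      (EuclideanSpace.single j (1 : ℝ)) := by
    refine setIntegral_eq_integral_of_forall_compl_eq_zero fun z hz => ?_
    have h1 : (fun z => disp L ε z i * g z) =ᶠ[𝓝 z] fun _ => 0 := by
      filter_upwards [(isClosed_tsupport g).isOpen_compl.mem_nhds fun h => hz (hs h)] with w hw
      rw [image_eq_zero_of_notMem_tsupport hw, mul_zero]
    rw [h1.lineDeriv_eq]
    simp [lineDeriv]
  rw [← integral_lineDeriv_eq_zero hlip hcs (EuclideanSpace.single j (1 : ℝ)), ← hset]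
  refine integral_congr_ae ?_
  filter_upwards [ae_mem_cell hL] with z ⟨k, c, hz⟩
  have h1 := hasFDerivAt_disp hL ε hz
  have h2 : HasFDerivAt (fun w => disp L ε w i)
      ((EuclideanSpace.proj i : Plane →L[ℝ] ℝ).comp (fderiv ℝ (disp L ε) z)) z :=
    (EuclideanSpace.proj i : Plane →L[ℝ] ℝ).hasFDerivAt.comp z
      h1.differentiableAt.hasFDerivAt
  have h3 := (hg.differentiable (by simp) z).hasFDerivAt
  have h4 := (h2.mul h3).hasLineDerivAt (EuclideanSpace.single j (1 : ℝ))
  have h5 : lineDeriv ℝ (fun z => disp L ε z i * g z) z (EuclideanSpace.single j (1 : ℝ)) = _ :=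
    h4.lineDeriv
  rw [h5]
  simp [grad]
  ring

/-- A smooth bump at the origin. -/
def bump : ContDiffBump (0 : Plane) := ⟨1, 2, one_pos, one_lt_two⟩

lemma bump_contDiff : ContDiff ℝ ∞ (bump : Plane → ℝ) := bump.contDiff

lemma exists_bound_fderiv_bump : ∃ B, ∀ z, ‖fderiv ℝ (bump : Plane → ℝ) z‖ ≤ B :=
  (bump.hasCompactSupport.fderiv ℝ).exists_bound_of_continuous
    (bump_contDiff.continuous_fderiv (by simp))

lemma fderiv_bump_eq_zero {z : Plane} (h : 2 < ‖z‖) : fderiv ℝ (bump : Plane → ℝ) z = 0 := by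
  refine image_eq_zero_of_notMem_tsupport fun h' => ?_
  have h1 := tsupport_fderiv_subset ℝ h'
  rw [bump.tsupport_eq, mem_closedBall_zero_iff] at h1
  exact not_le.2 h h1

lemma hasFDerivAt_bump_smul (N : ℝ) (z : Plane) :
    HasFDerivAt (fun z : Plane => 1 - bump (N • z)) (-(N • fderiv ℝ (bump : Plane → ℝ) (N • z))) z := by
  have h1 := (bump_contDiff.differentiable (by simp) (N • z)).hasFDerivAt
  have h2 : HasFDerivAt (fun z : Plane => N • z) (N • ContinuousLinearMap.id ℝ Plane) z :=
    (hasFDerivAt_id z).const_smul N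
  have h3 := (h1.comp z h2).const_sub 1
  refine h3.congr_fderiv ?_
  ext w
  simp

lemma tendsto_smul_bump {z : Plane} (hz : z ≠ 0) :
    Filter.Tendsto (fun n : ℕ => 1 - bump (((n : ℝ) + 1) • z)) Filter.atTop (𝓝 1) := by
  refine tendsto_const_nhds.congr' ?_
  filter_upwards [Filter.eventually_ge_atTop ⌈2 / ‖z‖⌉₊] with n hn
  have h1 : 2 / ‖z‖ ≤ n := (Nat.le_ceil _).trans (by exact_mod_cast hn)
  rw [div_le_iff₀ (norm_pos_iff.2 hz)] at h1
  have h2 : bump (((n : ℝ) + 1) • z) = 0 := by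
    refine bump.zero_of_le_dist ?_
    rw [dist_zero_right, norm_smul, Real.norm_of_nonneg (by positivity)]
    have : (0 : ℝ) ≤ ‖z‖ := norm_nonneg z
    change 2 ≤ _
    nlinarith
  rw [h2, sub_zero]

lemma tendsto_integral_mul_bump {s : Set Plane} {f : Plane → ℝ} (hf : IntegrableOn f s) :
    Filter.Tendsto (fun n : ℕ => ∫ z in s, f z * (1 - bump (((n : ℝ) + 1) • z)))
      Filter.atTop (𝓝 (∫ z in s, f z)) := by
  refine tendsto_integral_of_dominated_convergence (fun z => ‖f z‖) (fun n => ?_) hf.norm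
    (fun n => ?_) ?_
  · refine hf.aestronglyMeasurable.mul (Continuous.aestronglyMeasurable ?_)
    exact continuous_const.sub (bump.continuous.comp (continuous_const_smul _))
  · refine Filter.Eventually.of_forall fun z => ?_
    rw [norm_mul]
    refine mul_le_of_le_one_right (norm_nonneg _) ?_
    rw [Real.norm_eq_abs, abs_le]
    constructor <;> linarith [bump.nonneg (x := ((n : ℝ) + 1) • z),
      bump.le_one (x := ((n : ℝ) + 1) • z)]
  · filter_upwards [ae_restrict_of_ae (Measure.ae_ne volume (0 : Plane))] with z hz
    simpa using (tendsto_smul_bump hz).const_mul (f z)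

/-- With N = n + 1, the integrand is of order N and supported in a ball of radius 2/N, of area of
order 1/N². The integral is therefore of order 1/N. -/
lemma tendsto_integral_mul_fderiv_bump {s : Set Plane} {f : Plane → ℝ}
    {C : ℝ} (hC : ∀ z ∈ s, |f z| ≤ C) (w : Plane) (hs : MeasurableSet s) :
    Filter.Tendsto (fun n : ℕ => ∫ z in s, f z *
      (((n : ℝ) + 1) * fderiv ℝ (bump : Plane → ℝ) (((n : ℝ) + 1) • z) w))
      Filter.atTop (𝓝 0) := by
  obtain ⟨B, hB⟩ := exists_bound_fderiv_bump
  have hB0 : 0 ≤ B := (norm_nonneg _).trans (hB 0)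
  have key : ∀ n : ℕ, ‖∫ z in s, f z *
      (((n : ℝ) + 1) * fderiv ℝ (bump : Plane → ℝ) (((n : ℝ) + 1) • z) w)‖ ≤
      |C| * (B * ‖w‖) * 4 * volume.real (Metric.ball (0 : Plane) 1) * (1 / ((n : ℝ) + 1)) := by
    intro n
    have hn : (0 : ℝ) < n + 1 := by positivity
    rw [setIntegral_eq_of_subset_of_forall_sdiff_eq_zero hs
      (Set.inter_subset_left (t := Metric.closedBall (0 : Plane) (2 / ((n : ℝ) + 1)))) ?_]
    · refine (norm_setIntegral_le_of_norm_le_const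
        (C := |C| * (((n : ℝ) + 1) * (B * ‖w‖))) ?_ ?_).trans ?_
      · exact (measure_mono Set.inter_subset_right).trans_lt measure_closedBall_lt_top
      · intro z hz
        rw [norm_mul, norm_mul, Real.norm_of_nonneg hn.le]
        refine mul_le_mul ((hC z hz.1).trans (le_abs_self C)) ?_ (by positivity) (abs_nonneg C)
        refine mul_le_mul_of_nonneg_left ?_ hn.le
        exact ((fderiv ℝ (bump : Plane → ℝ) _).le_opNorm w).trans
          (mul_le_mul_of_nonneg_right (hB _) (norm_nonneg w))
      · have h1 : volume.real (s ∩ Metric.closedBall (0 : Plane) (2 / ((n : ℝ) + 1))) ≤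
            (2 / ((n : ℝ) + 1)) ^ 2 * volume.real (Metric.ball (0 : Plane) 1) := by
          refine (measureReal_mono Set.inter_subset_right measure_closedBall_lt_top.ne).trans ?_
          rw [Measure.addHaar_real_closedBall _ _ (by positivity)]
          simp
        refine (mul_le_mul_of_nonneg_left h1 (by positivity)).trans (le_of_eq ?_)
        field_simp
        ring
    · rintro z ⟨hz, hz'⟩
      rw [fderiv_bump_eq_zero]
      · simp
      · have h1 : 2 / ((n : ℝ) + 1) < ‖z‖ := by
          by_contra! h
          exact hz' ⟨hz, mem_closedBall_zero_iff.2 h⟩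
        rw [norm_smul, Real.norm_of_nonneg hn.le]
        rw [div_lt_iff₀ hn] at h1
        linarith
  refine squeeze_zero_norm key ?_
  simpa using tendsto_one_div_add_atTop_nhds_zero_nat.const_mul
    (|C| * (B * ‖w‖) * 4 * volume.real (Metric.ball (0 : Plane) 1))

lemma isWeakGradient_disp {L ε : ℝ} (hL : 0 < L) (hε : 0 < ε) :
    IsWeakGradient (disk L) (disp L ε) (grad (disp L ε)) := by
  refine ⟨fun i => (integrableOn_disp hL ε i).locallyIntegrableOn,
    fun i j => (integrableOn_grad_disp hL hε i j).locallyIntegrableOn, fun φ hφ hc hs i j => ?_⟩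
  set e : Plane := EuclideanSpace.single j (1 : ℝ)
  have hdφ : Continuous fun z => fderiv ℝ φ z e :=
    (hφ.continuous_fderiv (by simp)).clm_apply continuous_const
  obtain ⟨A, hA⟩ := hc.exists_bound_of_continuous hφ.continuous
  obtain ⟨A', hA'⟩ := (hc.fderiv_apply ℝ e).exists_bound_of_continuous hdφ
  obtain ⟨M, hM⟩ := exists_bound_disp hL ε i
  have i1 : IntegrableOn (fun z => grad (disp L ε) z i j * φ z) (disk L) :=
    (integrableOn_grad_disp hL hε i j).mul_bdd (c := A) hφ.continuous.aestronglyMeasurable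
      (Filter.Eventually.of_forall hA)
  have i2 : IntegrableOn (fun z => disp L ε z i * fderiv ℝ φ z e) (disk L) :=
    (integrableOn_disp hL ε i).mul_bdd (c := A') hdφ.aestronglyMeasurable
      (Filter.Eventually.of_forall hA')
  have i3 : IntegrableOn (fun z => disp L ε z i * φ z) (disk L) :=
    (integrableOn_disp hL ε i).mul_bdd (c := A) hφ.continuous.aestronglyMeasurable
      (Filter.Eventually.of_forall hA)
  have h1 := tendsto_integral_mul_bump (i1.add i2)
  have h2 := tendsto_integral_mul_fderiv_bump (s := disk L) (f := fun z => disp L ε z i * φ z)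
    (C := M * A) (fun z hz => by
      rw [abs_mul]
      exact mul_le_mul (hM z (subset_closure hz)) (hA z) (abs_nonneg _) ((abs_nonneg _).trans (hM z (subset_closure hz))))
    e (measurableSet_disk L)
  -- The punctured identity is applied to φ times the cutoff; differentiating the cutoff produces
  -- the right-hand side. As n grows, the left tends to the full integral and the right to 0.
  have h3 : ∀ n : ℕ, (∫ z in disk L, (grad (disp L ε) z i j * φ z +
      disp L ε z i * fderiv ℝ φ z e) * (1 - bump (((n : ℝ) + 1) • z))) =
      ∫ z in disk L, disp L ε z i * φ z *
        (((n : ℝ) + 1) * fderiv ℝ (bump : Plane → ℝ) (((n : ℝ) + 1) • z) e) := by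
    intro n
    have hn : (0 : ℝ) < n + 1 := by positivity
    have hbump : Continuous fun z : Plane => 1 - bump (((n : ℝ) + 1) • z) :=
      continuous_const.sub (bump.continuous.comp (continuous_const_smul _))
    have hsmooth : ContDiff ℝ ∞ fun z : Plane => 1 - bump (((n : ℝ) + 1) • z) :=
      contDiff_const.sub (bump_contDiff.comp (contDiff_const_smul _))
    obtain ⟨B, hB⟩ := exists_bound_fderiv_bump
    have j1 : IntegrableOn (fun z => (grad (disp L ε) z i j * φ z +
        disp L ε z i * fderiv ℝ φ z e) * (1 - bump (((n : ℝ) + 1) • z))) (disk L) := by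
      refine (i1.add i2).mul_bdd (c := 1) hbump.aestronglyMeasurable
        (Filter.Eventually.of_forall fun z => ?_)
      rw [Real.norm_eq_abs, abs_le]
      constructor <;> linarith [bump.nonneg (x := ((n : ℝ) + 1) • z),
        bump.le_one (x := ((n : ℝ) + 1) • z)]
    have j2 : IntegrableOn (fun z => disp L ε z i * φ z *
        (((n : ℝ) + 1) * fderiv ℝ (bump : Plane → ℝ) (((n : ℝ) + 1) • z) e)) (disk L) := by
      refine i3.mul_bdd (c := (((n : ℝ) + 1) * (B * ‖e‖))) (Continuous.aestronglyMeasurable ?_)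
        (Filter.Eventually.of_forall fun z => ?_)
      · exact continuous_const.mul (((bump_contDiff.continuous_fderiv (by simp)).comp
          (continuous_const_smul _)).clm_apply continuous_const)
      · rw [norm_mul, Real.norm_of_nonneg hn.le]
        exact mul_le_mul_of_nonneg_left (((fderiv ℝ (bump : Plane → ℝ) _).le_opNorm e).trans
          (mul_le_mul_of_nonneg_right (hB _) (norm_nonneg e))) hn.le
    have h4 := integral_grad_mul_add_eq_zero hL ε i j
      (g := fun z => φ z * (1 - bump (((n : ℝ) + 1) • z))) (hφ.mul hsmooth) hc.mul_right
      ((closure_mono (Function.support_mul_subset_left _ _)).trans hs)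
      -- The bump equals 1 on the unit ball, so the rescaled cutoff vanishes within this distance of
      -- the origin.
      (δ := 1 / ((n : ℝ) + 1)) (by positivity) (fun z hz => by
        rw [bump.one_of_mem_closedBall, sub_self, mul_zero]
        rw [mem_closedBall_zero_iff, norm_smul, Real.norm_of_nonneg hn.le]
        rw [lt_div_iff₀ hn] at hz
        change _ ≤ 1
        linarith)
    rw [← sub_eq_zero, ← integral_sub j1 j2, ← h4]
    refine integral_congr_ae (Filter.Eventually.of_forall fun z => ?_)
    have h5 : HasFDerivAt (fun z => φ z * (1 - bump (((n : ℝ) + 1) • z))) _ z :=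
      (hφ.differentiable (by simp) z).hasFDerivAt.mul
        (hasFDerivAt_bump_smul ((n : ℝ) + 1) z)
    simp only [h5.fderiv]
    simp [e]
    ring
  simp only [Pi.add_apply, h3] at h1
  have h4 := tendsto_nhds_unique h1 h2
  rw [integral_add i1 i2] at h4
  simp only [mul_comm (φ _)]
  linarith

lemma memSobolev_disp {L ε : ℝ} (hL : 0 < L) (hε : 0 < ε) {p : ℝ≥0∞} (hp : p ≠ ⊤) :
    MemSobolev (disk L) (disp L ε) p :=
  ⟨fun i => memLp_disp hL ε i p, _, isWeakGradient_disp hL hε,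
    fun i j => memLp_grad_disp hL hε i j hp⟩

/-! ### Growth of the rotation and failure of the Lipschitz property -/

lemma skewPart_grad_disp_bounds {L ε : ℝ} (hL : 0 < L) (hε : 0 < ε) {k : ℕ} (hk : 1 ≤ k) {c : Cell}
    {z : Plane} (hz : z ∈ cell L k c) {i j : Fin 2} (hij : i ≠ j) :
    ε * √3 * k ≤ |skewPart (grad (disp L ε) z) i j| ∧
      |skewPart (grad (disp L ε) z) i j| ≤ 2 * ε * √3 * k := by
  rw [grad_disp hL ε hz]
  exact skewPart_bounds hε hk c hij

lemma abs_skewPart_grad_le (u : Plane → Plane) (z : Plane) (i j : Fin 2) :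
    |skewPart (grad u z) i j| ≤ ‖fderiv ℝ u z‖ := by
  have h : ∀ i j, |grad u z i j| ≤ ‖fderiv ℝ u z‖ := fun i j => by
    refine (PiLp.norm_apply_le _ i).trans (((fderiv ℝ u z).le_opNorm _).trans ?_)
    simp
  have e : skewPart (grad u z) i j = 1 / 2 * (grad u z i j - grad u z j i) := rfl
  have h1 := abs_le.1 (h i j)
  have h2 := abs_le.1 (h j i)
  rw [e, abs_le]
  constructor <;> linarith [h1.1, h1.2, h2.1, h2.2]

/-- A Lipschitz constant would bound the derivative at every interior point, hence its skew part,
which is at least ε√3 k on level k. -/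
lemma not_lipschitzOnWith_disp {L ε : ℝ} (hL : 0 < L) (hε : 0 < ε) :
    ¬ ∃ K, LipschitzOnWith K (disp L ε) (disk L) := by
  rintro ⟨K, hK⟩
  have hpos : 0 < ε * √3 := mul_pos hε sqrt_three_pos
  obtain ⟨n, hn⟩ := exists_nat_gt ((K : ℝ) / (ε * √3))
  obtain ⟨z, hz⟩ := cell_nonempty hL (n + 1) .A
  have h1 := (skewPart_grad_disp_bounds hL hε (by omega) hz (zero_ne_one (α := Fin 2))).1
  have h2 := abs_skewPart_grad_le (disp L ε) z 0 1
  have h3 : ‖fderiv ℝ (disp L ε) z‖ ≤ K :=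
    norm_fderiv_le_of_lipschitzOn ℝ (Metric.isOpen_ball.mem_nhds (cell_subset_disk hL _ _ hz)) hK
  rw [div_lt_iff₀ hpos] at hn
  push_cast at h1
  linarith

end Tripole

end

theorem theorem1 (L ε : ℝ) (hL : 0 < L) (hε : 0 < ε) :
    -- the cells: open, pairwise disjoint, filling the disk up to a null set
    ((∀ k X, IsOpen (Tripole.cell L k X)) ∧
      (Pairwise fun i j : ℕ × Tripole.Cell =>
        Disjoint (Tripole.cell L i.1 i.2) (Tripole.cell L j.1 j.2)) ∧
      (∀ k X, Tripole.cell L k X ⊆ Tripole.disk L) ∧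
      volume (Tripole.disk L \ ⋃ k, ⋃ X, Tripole.cell L k X) = 0) ∧
    -- kites (apart from the three outermost cells cut off by the circle), self-similar,
    -- nonempty, and accumulating at the origin
    (∀ k X, (k = 0 → X = .A ∨ X = .E ∨ X = .F) →
      Tripole.IsOpenKite (Tripole.cell L k X)) ∧
    Tripole.SelfSimilar L ∧
    (∀ k X, (Tripole.cell L k X).Nonempty) ∧
    (∀ U ∈ 𝓝 (0 : Tripole.Plane), ∀ᶠ k in Filter.atTop, ∀ X, Tripole.cell L k X ⊆ U) ∧
    ∃ u : Tripole.Plane → Tripole.Plane,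
      -- the explicit piecewise affine displacement
      (∀ k X, ∀ z ∈ Tripole.cell L k X,
        u z = ε • (Tripole.v L k X z + Tripole.shift L k)) ∧
      u 0 = (ε * L / (1 - Tripole.t ^ 2)) • !₂[√3 - 2, 1] ∧
      -- 1) continuity on the closed disk
      ContinuousOn u (closure (Tripole.disk L)) ∧
      -- 2) the strain takes only the three values almost everywhere
      (∀ᵐ z ∂(volume.restrict (Tripole.disk L)), DifferentiableAt ℝ u z ∧
        ∃ i, Tripole.symPart (Tripole.grad u z) = Tripole.strain ε i) ∧
      -- 3) the three variants have the same area
      (∀ i, volume (Tripole.phase ε (Tripole.disk L) u i) =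
        ENNReal.ofReal (Real.pi / 3 * Tripole.radius L ^ 2)) ∧
      -- 4) Sobolev regularity, and failure of Lipschitz continuity
      Tripole.IsWeakGradient (Tripole.disk L) u (Tripole.grad u) ∧
      (∀ p : ℝ≥0∞, 1 ≤ p → p ≠ ⊤ → Tripole.MemSobolev (Tripole.disk L) u p) ∧
      (¬ ∃ K, LipschitzOnWith K u (Tripole.disk L)) ∧
      -- linear growth of the skew part of the gradient in the nesting level
      ∃ c₁ c₂ : ℝ, 0 < c₁ ∧ 0 < c₂ ∧ ∀ k : ℕ, 1 ≤ k → ∀ X, ∀ z ∈ Tripole.cell L k X,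
        ∀ i j : Fin 2, i ≠ j →
          c₁ * k ≤ |Tripole.skewPart (Tripole.grad u z) i j| ∧
          |Tripole.skewPart (Tripole.grad u z) i j| ≤ c₂ * k := by
  refine ⟨⟨fun k X => Tripole.isOpen_cell hL k X, Tripole.pairwise_disjoint_cell hL,
      fun k X => Tripole.cell_subset_disk hL k X, Tripole.volume_disk_diff_cells hL⟩,
    fun k X h => Tripole.isOpenKite_cell hL k X h, Tripole.selfSimilar hL,
    fun k X => Tripole.cell_nonempty hL k X, fun U hU => Tripole.eventually_cell_subset hL hU,
    Tripole.disp L ε, fun k X z hz => Tripole.disp_eq_of_mem_cell hL ε hz, Tripole.disp_zero hL ε,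
    Tripole.continuousOn_disp hL ε, ?_, fun i => Tripole.volume_phase hL hε i,
    Tripole.isWeakGradient_disp hL hε, fun p _ hp => Tripole.memSobolev_disp hL hε hp,
    Tripole.not_lipschitzOnWith_disp hL hε,
    ε * √3, 2 * ε * √3, by positivity, by positivity, fun k hk X z hz i j hij =>
      Tripole.skewPart_grad_disp_bounds hL hε hk hz hij⟩
  filter_upwards [Tripole.ae_mem_cell hL] with z ⟨k, c, hz⟩
  refine ⟨(Tripole.hasFDerivAt_disp hL ε hz).differentiableAt, Tripole.cellStrain c, ?_⟩
  rw [Tripole.grad_disp hL ε hz, Tripole.symPart_cellGrad]
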